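/- Let $G=\widetilde{\mathrm{SL}(2,\mathbb R)}$ be the universal covering group of $\mathrm{SL}(2,\mathbb R)$, and let $(F_1,F_2,F_3)$ be a frame of left-invariant vector fields on $G$ with $$[F_2,F_3]=-2F_1,\qquad [F_3,F_1]=2F_2,\qquad [F_1,F_2]=2F_3,$$ with dual coframe $(\omega^1,\omega^2,\omega^3)$. Let $g_0=A_0\,\omega^1\otimes\omega^1+B_0\,\omega^2\otimes\omega^2+C_0\,\omega^3\otimes\omega^3$ be a left-invariant Riemannian metric with $A_0>0$ and $B_0=C_0>0$, and put $h=\omega^1\otimes\omega^1+\omega^2\otimes\omega^2+\omega^3\otimes\omega^3$. For a Riemannian metric $g$ on $G$, with Levi-Civita connection $\nabla$, Ricci tensor $R_{ij}$, scalar curvature $R$ and volume measure $\mu_g$, the Cotton–York tensor is $$C_2=C_{ij}=g_{ik}\,\varepsilon^{klm}\Bigl(\nabla_lR_{mj}-\tfrac14\nabla_lR\,g_{mj}\Bigr),\qquad \varepsilon^{klm}=\frac{\eta^{klm}}{\sqrt{\det g}},$$ where $\eta^{klm}$ is the completely antisymmetric symbol with $\eta^{123}=1$; its norm is $|C_2|_g=(g^{ip}g^{jq}C_{ij}C_{pq})^{1/2}$,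 and for compact $K\subset G$ put $C_K(g)=\int_K|C_2|_g\,d\mu_g$. Then a solution $g(t)$, $0\le t<\infty$, of the Ricci flow $\partial_t g=-2\,\mathrm{Ric}_g$ through left-invariant metrics with $g(0)=g_0$ exists, and every such solution has the following properties. There are functions $A,B>0$ on $[0,\infty)$ with $$g(t)=A(t)\,\omega^1\otimes\omega^1+B(t)\,(\omega^2\otimes\omega^2+\omega^3\otimes\omega^3),\qquad t\ge 0,$$ and for every compact set $K\subset G$ $$C_K(g(t))=4\sqrt6\,\frac{A(t)}{B(t)}\Bigl(1+\frac{A(t)}{B(t)}\Bigr)\mathrm{Vol}(K,h),\qquad t\ge0.$$ Moreover $C_K(g(t))\to0$ as $t\to\infty$, and if $\mathrm{Vol}(K,h)>0$, then $t\mapsto C_K(g(t))$ is strictly decreasing on $[0,\infty)$. -/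

import Mathlib

open scoped Manifold ContDiff Topology
open MeasureTheory Bundle

noncomputable section

namespace CottonYork

/-- The model space of three-dimensional manifolds. -/
abbrev E3 : Type := EuclideanSpace ℝ (Fin 3)

/-! ### Three-dimensional Riemannian geometry -/

section Manifold

variable {M : Type*} [TopologicalSpace M] [ChartedSpace E3 M]

/-- A smooth Riemannian metric on a smooth three-dimensional manifold. -/
abbrev Metric (M : Type*) [TopologicalSpace M] [ChartedSpace E3 M] [IsManifold (𝓡 3) ∞ M] :
    Type _ :=
  ContMDiffRiemannianMetric (𝓡 3) ∞ E3 (fun x : M => TangentSpace (𝓡 3) x)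

/-- A (not necessarily smooth) vector field on `M`. -/
abbrev VField (M : Type*) [TopologicalSpace M] [ChartedSpace E3 M] : Type _ :=
  (x : M) → TangentSpace (𝓡 3) x

/-- The derivative `X f` of a function `f` along a vector field `X`. -/
def dirDeriv (X : VField M) (f : M → ℝ) (x : M) : ℝ :=
  mfderiv (𝓡 3) 𝓘(ℝ, ℝ) f x (X x)

/-- The Lie bracket `[X, Y]` of two vector fields. -/
def bracket (X Y : VField M) : VField M :=
  VectorField.mlieBracket (𝓡 3) X Y

variable [IsManifold (𝓡 3) ∞ M]

/-- The function `g(X, Y)`. -/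
def pair (g : Metric M) (X Y : VField M) (x : M) : ℝ :=
  g.inner x (X x) (Y x)

/-- The Koszul formula for the Levi-Civita connection of `g`: this is `g(∇_X Y, Z)`. -/
def koszul (g : Metric M) (X Y Z : VField M) (x : M) : ℝ :=
  (1 / 2) * (dirDeriv X (pair g Y Z) x + dirDeriv Y (pair g X Z) x - dirDeriv Z (pair g X Y) x
    + pair g (bracket X Y) Z x - pair g (bracket X Z) Y x - pair g (bracket Y Z) X x)

/-! Below, `F` is a frame: three vector fields that form a basis of each tangent space. All tensors
are given by their components with respect to `F`. -/

/-- The components `g_{ij} = g(F_i, F_j)` of the metric. -/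
def gram (g : Metric M) (F : Fin 3 → VField M) (x : M) : Matrix (Fin 3) (Fin 3) ℝ :=
  Matrix.of fun i j => pair g (F i) (F j) x

/-- The components `g^{ij}` of the inverse metric. -/
def gramInv (g : Metric M) (F : Fin 3 → VField M) (x : M) : Matrix (Fin 3) (Fin 3) ℝ :=
  (gram g F x)⁻¹

/-- The structure functions of the frame: `[F_i, F_j] = ∑ k, c_{ij}^k F_k`. -/
def structFun (g : Metric M) (F : Fin 3 → VField M) (i j k : Fin 3) (x : M) : ℝ :=
  ∑ l, pair g (bracket (F i) (F j)) (F l) x * gramInv g F x l k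

/-- The coefficients of the Levi-Civita connection: `∇_{F_i} F_j = ∑ k, Γ_{ij}^k F_k`. -/
def christoffel (g : Metric M) (F : Fin 3 → VField M) (i j k : Fin 3) (x : M) : ℝ :=
  ∑ l, koszul g (F i) (F j) (F l) x * gramInv g F x l k

/-- The components of the curvature tensor: `R(F_i, F_j) F_k = ∑ m, R_{ijk}^m F_m`, where
`R(X, Y) Z = ∇_X ∇_Y Z - ∇_Y ∇_X Z - ∇_{[X, Y]} Z`. -/
def riem (g : Metric M) (F : Fin 3 → VField M) (i j k m : Fin 3) (x : M) : ℝ :=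
  dirDeriv (F i) (christoffel g F j k m) x - dirDeriv (F j) (christoffel g F i k m) x
    + ∑ p, christoffel g F j k p x * christoffel g F i p m x
    - ∑ p, christoffel g F i k p x * christoffel g F j p m x
    - ∑ p, structFun g F i j p x * christoffel g F p k m x

/-- The components `R_{jk}` of the Ricci tensor, `Ric(Y, Z) = tr (X ↦ R(X, Y) Z)`. -/
def ricci (g : Metric M) (F : Fin 3 → VField M) (j k : Fin 3) (x : M) : ℝ :=
  ∑ i, riem g F i j k i x

/-- The scalar curvature `R = g^{jk} R_{jk}`. -/
def scalarCurv (g : Metric M) (F : Fin 3 → VField M) (x : M) : ℝ :=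
  ∑ j, ∑ k, gramInv g F x j k * ricci g F j k x

/-- The components `∇_l R_{mj}` of the covariant derivative of the Ricci tensor. -/
def covRicci (g : Metric M) (F : Fin 3 → VField M) (l m j : Fin 3) (x : M) : ℝ :=
  dirDeriv (F l) (ricci g F m j) x
    - ∑ p, christoffel g F l m p x * ricci g F p j x
    - ∑ p, christoffel g F l j p x * ricci g F m p x

/-- The completely antisymmetric symbol `η^{klm}` with `η^{123} = 1`: the sign of `(k, l, m)` as a
permutation of the three indices, and zero if two of them agree. -/
def eta (k l m : Fin 3) : ℝ :=
  ((1 : Matrix (Fin 3) (Fin 3) ℝ).submatrix ![k, l, m] id).det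

/-- The components of the Cotton-York tensor,
`C_{ij} = g_{ik} ε^{klm} (∇_l R_{mj} - (1/4) (∇_l R) g_{mj})` with `ε^{klm} = η^{klm} / √(det g)`. -/
def cottonYork (g : Metric M) (F : Fin 3 → VField M) (i j : Fin 3) (x : M) : ℝ :=
  ∑ k, ∑ l, ∑ m, gram g F x i k * (eta k l m / √(gram g F x).det) *
    (covRicci g F l m j x - (1 / 4) * dirDeriv (F l) (scalarCurv g F) x * gram g F x m j)

/-- The norm `|C_2|_g = (g^{ip} g^{jq} C_{ij} C_{pq})^{1/2}` of the Cotton-York tensor. -/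
def cottonYorkNorm (g : Metric M) (F : Fin 3 → VField M) (x : M) : ℝ :=
  √(∑ i, ∑ j, ∑ p, ∑ q, gramInv g F x i p * gramInv g F x j q *
    cottonYork g F i j x * cottonYork g F p q x)

/-! ### The Riemannian volume measure -/

/-- The coordinate vector field `∂/∂x^i` of the chart `e`, at the point with coordinates `y`. -/
def coordVec (e : OpenPartialHomeomorph M E3) (i : Fin 3) (y : E3) :
    TangentSpace (𝓡 3) (e.symm y) :=
  mfderiv (𝓡 3) (𝓡 3) e.symm y (EuclideanSpace.single i (1 : ℝ) : E3)

/-- The volume density `√(det g_{ij})` of `g` in the chart `e`. -/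
def volDensity (g : Metric M) (e : OpenPartialHomeomorph M E3) (y : E3) : ℝ :=
  √(Matrix.det (Matrix.of fun i j : Fin 3 =>
    g.inner (e.symm y) (coordVec e i y) (coordVec e j y)))

variable [MeasurableSpace M]

/-- The measure `√(det g_{ij}) dx^1 dx^2 dx^3` of the chart `e`, as a measure on `M` that lives on
the domain of `e`. -/
def chartVolume (g : Metric M) (e : OpenPartialHomeomorph M E3) : Measure M :=
  (((volume : Measure E3).restrict e.target).withDensity
    fun y => ENNReal.ofReal (volDensity g e y)).map e.symm

/-- The Riemannian volume measure: the measure on `M` that restricts to `chartVolume g e` on the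
domain of each chart `e`. Since the measures of the charts agree on overlaps, it is their supremum
in the lattice of measures. -/
def riemVolume (g : Metric M) : Measure M :=
  ⨆ x : M, chartVolume g (chartAt E3 x)

/-- The `L¹`-norm `∫_K |C_2|_g dμ_g` of the Cotton-York tensor on `K`. -/
def cottonYorkL1 (g : Metric M) (F : Fin 3 → VField M) (K : Set M) : ℝ :=
  ∫ x in K, cottonYorkNorm g F x ∂(riemVolume g)

end Manifold

/-! ### Left-invariant geometry on three-dimensional Lie groups -/

section LieGroup

variable {G : Type*} [TopologicalSpace G] [ChartedSpace E3 G] [Group G]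

/-- The left-invariant frame field with the values `e i` at the identity. -/
def frame (e : Module.Basis (Fin 3) ℝ (GroupLieAlgebra (𝓡 3) G)) : Fin 3 → VField G :=
  fun i => mulInvariantVectorField (e i)

/-- The bracket relations of a Milnor frame `(F_1, F_2, F_3)`:
`[F_2, F_3] = 2 λ F_1`, `[F_3, F_1] = 2 μ F_2`, `[F_1, F_2] = 2 ν F_3`. -/
structure MilnorRelations (e : Module.Basis (Fin 3) ℝ (GroupLieAlgebra (𝓡 3) G))
    (lam mu nu : ℝ) : Prop where
  rel1 : ⁅e 1, e 2⁆ = (2 * lam) • e 0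
  rel2 : ⁅e 2, e 0⁆ = (2 * mu) • e 1
  rel3 : ⁅e 0, e 1⁆ = (2 * nu) • e 2

/-- `p` exhibits the topological group `G` as the universal covering group of `SL(2, ℝ)`. -/
structure IsUniversalCoverSL2 (p : G →* Matrix.SpecialLinearGroup (Fin 2) ℝ) : Prop where
  simplyConnected : SimplyConnectedSpace G
  isCoveringMap : IsCoveringMap p
  surjective : Function.Surjective p

variable [LieGroup (𝓡 3) ∞ G]

/-- Left translations are isometries of `g`. -/
def IsLeftInvariant (g : Metric G) : Prop :=
  ∀ (a x : G) (v w : TangentSpace (𝓡 3) x),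
    g.inner (a * x) (mfderiv (𝓡 3) (𝓡 3) (fun y : G => a * y) x v)
      (mfderiv (𝓡 3) (𝓡 3) (fun y : G => a * y) x w) = g.inner x v w

/-- `g = A ω^1 ⊗ ω^1 + B ω^2 ⊗ ω^2 + C ω^3 ⊗ ω^3`, where the `ω^i` are the left-invariant one-forms
dual to the frame of `e`. -/
def IsLeftInvariantDiagonal (g : Metric G)
    (e : Module.Basis (Fin 3) ℝ (GroupLieAlgebra (𝓡 3) G)) (A B C : ℝ) : Prop :=
  IsLeftInvariant g ∧
    ∀ (x : G), gram g (frame e) x = Matrix.diagonal ![A, B, C]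

/-- `g(t)`, `0 ≤ t < ∞`, is a solution of the Ricci flow `∂g/∂t = -2 Ric` (one-sided derivative at
`t = 0`) through left-invariant metrics. The values `g t` with `t < 0` play no role. -/
structure IsLeftInvariantRicciFlow (g : ℝ → Metric G)
    (e : Module.Basis (Fin 3) ℝ (GroupLieAlgebra (𝓡 3) G)) : Prop where
  leftInvariant : ∀ t, 0 ≤ t → IsLeftInvariant (g t)
  ricciFlow : ∀ t, 0 ≤ t → ∀ (x : G) (i j : Fin 3),
    HasDerivWithinAt (fun s => gram (g s) (frame e) x i j)
      (-2 * ricci (g t) (frame e) i j x) (Set.Ici 0) t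

end LieGroup

end CottonYork

end

/-
In a left-invariant frame the metric `g` and the bracket have constant components, so the whole
tensor calculus becomes algebra. For a diagonal metric in a frame with `[F_i, F_j] = 2 λ_k F_k`
(`(i, j, k)` cyclic) both the Ricci and the Cotton-York tensor are diagonal, and
`|C_2|_g √(det g)` is an explicit function of the diagonal entries. The Ricci flow is an ordinary
differential equation for the components of `g`; its solutions are unique, hence stay of the form
`diag (A, B, B)`, and `A' = -4 A² / B²`, `B' = 8 + 4 A / B`.

This system is integrated by a quadrature, which gives existence for all `t ≥ 0`. Along a solution
`ρ = A / B` satisfies `ρ' = -8 ρ (1 + ρ) / B < 0`, while `A` decreases and `B` grows at least like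
`8 t`, so `ρ` decreases strictly to `0`. Finally `μ_g = √(det g) μ_h` turns the `L¹`-norm into
`4 √6 ρ (1 + ρ) Vol(K, h)`.
-/

noncomputable section

namespace CottonYork

/-! ### Frames with constant structure functions and constant metric components -/

section ConstantComponents

/-- The Koszul formula `g(∇_{F_i} F_j, F_l)` for a frame `F` with structure constants `c` and a
metric `g` with constant components `P`. -/
def koszulConst (c : Fin 3 → Fin 3 → Fin 3 → ℝ) (P : Matrix (Fin 3) (Fin 3) ℝ)
    (i j l : Fin 3) : ℝ :=
  (1 / 2) * (∑ k, c i j k * P k l - ∑ k, c i l k * P k j - ∑ k, c j l k * P k i)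

/-- The connection coefficients `Γ_{ij}^k` for a frame with structure constants `c` and a metric
with constant components `P`. -/
def christoffelConst (c : Fin 3 → Fin 3 → Fin 3 → ℝ) (P : Matrix (Fin 3) (Fin 3) ℝ)
    (i j k : Fin 3) : ℝ :=
  ∑ l, koszulConst c P i j l * P⁻¹ l k

/-- The Ricci components `R_{jk}` for a frame with structure constants `c` and a metric with
constant components `P`. -/
def ricciConst (c : Fin 3 → Fin 3 → Fin 3 → ℝ) (P : Matrix (Fin 3) (Fin 3) ℝ)
    (j k : Fin 3) : ℝ :=
  ∑ i, (∑ p, christoffelConst c P j k p * christoffelConst c P i p i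
    - ∑ p, christoffelConst c P i k p * christoffelConst c P j p i
    - ∑ p, c i j p * christoffelConst c P p k i)

variable {M : Type*} [TopologicalSpace M] [ChartedSpace E3 M]

lemma dirDeriv_const (X : VField M) (a : ℝ) (x : M) : dirDeriv X (fun _ => a) x = 0 := by
  rw [dirDeriv, mfderiv_const]
  rfl

variable [IsManifold (𝓡 3) ∞ M]

lemma pair_sum_smul_left (g : Metric M) {ι : Type*} (s : Finset ι) (a : ι → ℝ) (X : ι → VField M)
    (Y : VField M) (x : M) :
    pair g (∑ k ∈ s, a k • X k) Y x = ∑ k ∈ s, a k * pair g (X k) Y x := by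
  simp only [pair, Finset.sum_apply, Pi.smul_apply, map_sum, map_smul]
  simp

/-- `F` is a frame with structure constants `c`, and `g` has the constant components `P` in it. -/
structure HasConstantComponents (g : Metric M) (F : Fin 3 → VField M)
    (c : Fin 3 → Fin 3 → Fin 3 → ℝ) (P : Matrix (Fin 3) (Fin 3) ℝ) : Prop where
  gram_eq : ∀ x, gram g F x = P
  bracket_eq : ∀ i j, bracket (F i) (F j) = ∑ k, c i j k • F k

namespace HasConstantComponents

variable {g : Metric M} {F : Fin 3 → VField M} {c : Fin 3 → Fin 3 → Fin 3 → ℝ}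
  {P : Matrix (Fin 3) (Fin 3) ℝ}

lemma pair_eq (h : HasConstantComponents g F c P) (i j : Fin 3) :
    pair g (F i) (F j) = fun _ => P i j :=
  funext fun x => congrFun₂ (h.gram_eq x) i j

lemma pair_bracket (h : HasConstantComponents g F c P) (i j l : Fin 3) (x : M) :
    pair g (bracket (F i) (F j)) (F l) x = ∑ k, c i j k * P k l := by
  simp only [h.bracket_eq, pair_sum_smul_left, h.pair_eq]

lemma koszul_eq (h : HasConstantComponents g F c P) (i j l : Fin 3) (x : M) :
    koszul g (F i) (F j) (F l) x = koszulConst c P i j l := by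
  simp only [koszul, h.pair_bracket, h.pair_eq, dirDeriv_const, koszulConst]
  ring

lemma christoffel_eq (h : HasConstantComponents g F c P) (i j k : Fin 3) :
    christoffel g F i j k = fun _ => christoffelConst c P i j k := by
  funext x
  simp only [christoffel, h.koszul_eq, gramInv, h.gram_eq, christoffelConst]

lemma structFun_eq (h : HasConstantComponents g F c P) (hP : P.det ≠ 0) (i j k : Fin 3) (x : M) :
    structFun g F i j k x = c i j k :=
  calc structFun g F i j k x
      = ((Matrix.of (c i) * P) * P⁻¹) j k := by
        simp only [structFun, h.pair_bracket, gramInv, h.gram_eq, Matrix.mul_apply, Matrix.of_apply]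
    _ = c i j k := by
        rw [Matrix.mul_nonsing_inv_cancel_right P _ hP.isUnit, Matrix.of_apply]

lemma ricci_eq (h : HasConstantComponents g F c P) (hP : P.det ≠ 0) (j k : Fin 3) :
    ricci g F j k = fun _ => ricciConst c P j k := by
  funext x
  simp only [ricci, riem, h.christoffel_eq, h.structFun_eq hP, dirDeriv_const, ricciConst, sub_zero,
    zero_add]

lemma dirDeriv_scalarCurv_eq_zero (h : HasConstantComponents g F c P) (hP : P.det ≠ 0)
    (X : VField M) (x : M) : dirDeriv X (scalarCurv g F) x = 0 := by
  have hR : scalarCurv g F = fun _ => ∑ j, ∑ k, P⁻¹ j k * ricciConst c P j k := by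
    funext y
    simp only [scalarCurv, gramInv, h.gram_eq, h.ricci_eq hP]
  rw [hR, dirDeriv_const]

end HasConstantComponents

end ConstantComponents

/-! ### Curvature of a diagonal metric in a Milnor frame -/

section Milnor

/-- The structure constants of a Milnor frame, `[F_i, F_j] = 2 λ_k F_k` for `(i, j, k)` a cyclic
permutation of `(0, 1, 2)`. -/
def milnorConst (lam : Fin 3 → ℝ) (i j k : Fin 3) : ℝ := eta i j k * (2 * lam k)

/-- Milnor's constants `μ_i = ½ (λ_0 d_0 + λ_1 d_1 + λ_2 d_2) - λ_i d_i`, doubled: they are the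
connection coefficients of the metric with components `diagonal d` in a Milnor frame. -/
def milnorCoeff (lam d : Fin 3 → ℝ) (i : Fin 3) : ℝ := ∑ k, lam k * d k - 2 * (lam i * d i)

/-- The diagonal Ricci components `R_{ii}` of the metric with components `diagonal d` in a Milnor
frame. The indices `i + 1` and `i + 2` are taken modulo `3`. -/
def milnorRicci (lam d : Fin 3 → ℝ) (i : Fin 3) : ℝ :=
  2 * milnorCoeff lam d (i + 1) * milnorCoeff lam d (i + 2) / (d (i + 1) * d (i + 2))

/-- The diagonal components of the Cotton-York tensor of the metric with components `diagonal d` in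
a Milnor frame, with the first index raised and multiplied by `√(det g)`. -/
def milnorCotton (lam d : Fin 3 → ℝ) (i : Fin 3) : ℝ :=
  milnorCoeff lam d (i + 1) *
      (milnorRicci lam d (i + 2) / d (i + 2) - milnorRicci lam d i / d i) +
    milnorCoeff lam d (i + 2) *
      (milnorRicci lam d (i + 1) / d (i + 1) - milnorRicci lam d i / d i)

lemma eta_eq (k l m : Fin 3) : eta k l m =
    ![![![0, 0, 0], ![0, 0, 1], ![0, -1, 0]], ![![0, 0, -1], ![0, 0, 0], ![1, 0, 0]],
      ![![0, 1, 0], ![-1, 0, 0], ![0, 0, 0]]] k l m := by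
  rw [eta, Matrix.det_fin_three]
  fin_cases k <;> fin_cases l <;> fin_cases m <;> simp [Matrix.one_apply]

lemma eta_swap_right (k l m : Fin 3) : eta k m l = -eta k l m := by
  fin_cases k <;> fin_cases l <;> fin_cases m <;> simp [eta_eq]

lemma eta_rotate (k l m : Fin 3) : eta l m k = eta k l m := by
  fin_cases k <;> fin_cases l <;> fin_cases m <;> simp [eta_eq]

lemma sum_sum_eta_mul_eta (i j : Fin 3) (f : Fin 3 → Fin 3 → ℝ) :
    ∑ l, ∑ m, eta i l m * eta j l m * f l m =
      if i = j then f (i + 1) (i + 2) + f (i + 2) (i + 1) else 0 := by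
  fin_cases i <;> fin_cases j <;> simp [Fin.sum_univ_three, eta_eq, add_comm]

lemma eta_mul_milnorCoeff (lam d : Fin 3 → ℝ) (i j k : Fin 3) :
    eta i j k * milnorCoeff lam d i = eta i j k * (lam j * d j + lam k * d k - lam i * d i) := by
  fin_cases i <;> fin_cases j <;> fin_cases k <;>
    simp [eta_eq, milnorCoeff, Fin.sum_univ_three] <;> ring

variable (lam : Fin 3 → ℝ) {d : Fin 3 → ℝ}

lemma koszulConst_milnor (i j l : Fin 3) :
    koszulConst (milnorConst lam) (Matrix.diagonal d) i j l = eta i j l * milnorCoeff lam d i := by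
  simp only [koszulConst, Matrix.diagonal_apply, mul_ite, mul_zero, Finset.sum_ite_eq',
    Finset.mem_univ, if_true, milnorConst, eta_mul_milnorCoeff]
  rw [eta_swap_right i j l, eta_rotate i j l]
  ring

lemma inv_diagonal_eq (hd : ∀ i, d i ≠ 0) :
    (Matrix.diagonal d)⁻¹ = Matrix.diagonal fun i => (d i)⁻¹ :=
  Matrix.inv_eq_right_inv <| by simp [Matrix.diagonal_mul_diagonal, hd]

lemma christoffelConst_milnor (hd : ∀ i, d i ≠ 0) (i j k : Fin 3) :
    christoffelConst (milnorConst lam) (Matrix.diagonal d) i j k =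
      eta i j k * milnorCoeff lam d i / d k := by
  simp only [christoffelConst, koszulConst_milnor, inv_diagonal_eq hd, Matrix.diagonal_apply,
    mul_ite, mul_zero, Finset.sum_ite_eq', Finset.mem_univ, if_true, div_eq_mul_inv]

lemma ricciConst_milnor (hd : ∀ i, d i ≠ 0) (j k : Fin 3) :
    ricciConst (milnorConst lam) (Matrix.diagonal d) j k =
      Matrix.diagonal (milnorRicci lam d) j k := by
  have h0 := hd 0
  have h1 := hd 1
  have h2 := hd 2
  simp only [ricciConst, christoffelConst_milnor lam hd]
  fin_cases j <;> fin_cases k <;>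
    simp [Fin.sum_univ_three, milnorConst, eta_eq, milnorRicci, milnorCoeff] <;> field_simp <;> ring

end Milnor

section ManifoldMilnor

variable {M : Type*} [TopologicalSpace M] [ChartedSpace E3 M] [IsManifold (𝓡 3) ∞ M]
  {g : Metric M} {F : Fin 3 → VField M} {lam d : Fin 3 → ℝ}

lemma det_diagonal_pos (hd : ∀ i, 0 < d i) : 0 < (Matrix.diagonal d).det := by
  rw [Matrix.det_diagonal]
  exact Finset.prod_pos fun i _ => hd i

lemma ricci_milnor (h : HasConstantComponents g F (milnorConst lam) (Matrix.diagonal d))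
    (hd : ∀ i, 0 < d i) (j k : Fin 3) :
    ricci g F j k = fun _ => Matrix.diagonal (milnorRicci lam d) j k := by
  rw [h.ricci_eq (det_diagonal_pos hd).ne', ricciConst_milnor lam fun i => (hd i).ne']

lemma covRicci_milnor (h : HasConstantComponents g F (milnorConst lam) (Matrix.diagonal d))
    (hd : ∀ i, 0 < d i) (l m j : Fin 3) (x : M) :
    covRicci g F l m j x = eta l m j * (milnorCoeff lam d l *
      (milnorRicci lam d m / d m - milnorRicci lam d j / d j)) := by
  simp only [covRicci, ricci_milnor h hd, dirDeriv_const, h.christoffel_eq,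
    christoffelConst_milnor lam fun i => (hd i).ne', Matrix.diagonal_apply, mul_ite, mul_zero,
    Finset.sum_ite_eq, Finset.sum_ite_eq', Finset.mem_univ, if_true]
  rw [eta_swap_right l m j]
  ring

lemma cottonYork_milnor (h : HasConstantComponents g F (milnorConst lam) (Matrix.diagonal d))
    (hd : ∀ i, 0 < d i) (i j : Fin 3) (x : M) :
    cottonYork g F i j x =
      Matrix.diagonal (fun i => d i / √(Matrix.diagonal d).det * milnorCotton lam d i) i j := by
  have hdet : (Matrix.diagonal d).det ≠ 0 := (det_diagonal_pos hd).ne'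
  calc cottonYork g F i j x
      = ∑ l, ∑ m, eta i l m * eta j l m * (d i / √(Matrix.diagonal d).det *
          (milnorCoeff lam d l * (milnorRicci lam d m / d m - milnorRicci lam d j / d j))) := by
        simp only [cottonYork, h.gram_eq, covRicci_milnor h hd,
          h.dirDeriv_scalarCurv_eq_zero hdet, Matrix.diagonal_apply, ite_mul, zero_mul,
          Finset.sum_ite_irrel, Finset.sum_const_zero, Finset.sum_ite_eq, Finset.mem_univ, if_true,
          mul_zero, sub_zero, eta_rotate j]
        refine Finset.sum_congr rfl fun l _ => Finset.sum_congr rfl fun m _ => ?_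
        ring
    _ = _ := by
        rw [sum_sum_eta_mul_eta, Matrix.diagonal_apply]
        split_ifs with hij
        · subst hij
          rw [milnorCotton]
          ring
        · rfl

lemma cottonYorkNorm_mul_sqrt_det
    (h : HasConstantComponents g F (milnorConst lam) (Matrix.diagonal d)) (hd : ∀ i, 0 < d i)
    (x : M) :
    cottonYorkNorm g F x * √(Matrix.diagonal d).det = √(∑ i, milnorCotton lam d i ^ 2) := by
  have hdet : 0 < (Matrix.diagonal d).det := det_diagonal_pos hd
  have hnorm : ∑ i, ∑ j, ∑ p, ∑ q, gramInv g F x i p * gramInv g F x j q *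
      cottonYork g F i j x * cottonYork g F p q x =
      (∑ i, milnorCotton lam d i ^ 2) / (Matrix.diagonal d).det := by
    simp only [gramInv, h.gram_eq, inv_diagonal_eq fun i => (hd i).ne', cottonYork_milnor h hd,
      Matrix.diagonal_apply, ite_mul, mul_ite, zero_mul, mul_zero, Finset.sum_ite_irrel,
      Finset.sum_const_zero, Finset.sum_ite_eq, Finset.mem_univ, if_true]
    rw [Finset.sum_div]
    refine Finset.sum_congr rfl fun i _ => ?_
    have hi := (hd i).ne'
    field_simp
    rw [Real.sq_sqrt hdet.le, mul_comm]
  rw [cottonYorkNorm, hnorm, Real.sqrt_div' _ hdet.le, div_mul_cancel₀ _ (by positivity)]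

end ManifoldMilnor

section Berger

variable {A B : ℝ}

lemma milnorRicci_berger (hA : A ≠ 0) (hB : B ≠ 0) :
    milnorRicci ![-1, 1, 1] ![A, B, B] =
      ![2 * A ^ 2 / B ^ 2, -4 - 2 * A / B, -4 - 2 * A / B] := by
  funext i
  fin_cases i <;> simp [milnorRicci, milnorCoeff, Fin.sum_univ_three] <;> field_simp <;> ring

lemma milnorCotton_berger (hA : A ≠ 0) (hB : B ≠ 0) :
    milnorCotton ![-1, 1, 1] ![A, B, B] =
      (4 * (A / B) * (1 + A / B)) • ![2, -1, -1] := by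
  funext i
  fin_cases i <;>
    simp [milnorCotton, milnorRicci_berger hA hB, milnorCoeff, Fin.sum_univ_three] <;>
    field_simp <;> ring

lemma sqrt_sum_milnorCotton_sq_berger (hA : 0 < A) (hB : 0 < B) :
    √(∑ i, milnorCotton ![-1, 1, 1] ![A, B, B] i ^ 2) = 4 * √6 * (A / B) * (1 + A / B) := by
  rw [← Real.sqrt_sq (by positivity : 0 ≤ 4 * √6 * (A / B) * (1 + A / B)),
    milnorCotton_berger hA.ne' hB.ne', Fin.sum_univ_three]
  congr 1
  simp only [mul_pow, Real.sq_sqrt (by norm_num : (0 : ℝ) ≤ 6), Pi.smul_apply, smul_eq_mul,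
    Matrix.cons_val]
  ring

end Berger

/-! ### The Ricci flow as an ordinary differential equation -/

section Uniqueness

variable {V : Type*} [NormedAddCommGroup V] [NormedSpace ℝ V]

theorem eq_of_hasDerivWithinAt_Ici {f : V → V} {U : Set V} (hf : ∀ v ∈ U, ContDiffAt ℝ 1 f v)
    {y z : ℝ → V} {a t : ℝ} (hy : ∀ s, a ≤ s → HasDerivWithinAt y (f (y s)) (Set.Ici a) s)
    (hz : ∀ s, a ≤ s → HasDerivWithinAt z (f (z s)) (Set.Ici a) s)
    (hyU : ∀ s, a ≤ s → y s ∈ U) (hzU : ∀ s, a ≤ s → z s ∈ U) (ha : y a = z a) (ht : a ≤ t) :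
    y t = z t := by
  have hyc : ContinuousOn y (Set.Icc a t) := fun s hs =>
    (hy s hs.1).continuousWithinAt.mono Set.Icc_subset_Ici_self
  have hzc : ContinuousOn z (Set.Icc a t) := fun s hs =>
    (hz s hs.1).continuousWithinAt.mono Set.Icc_subset_Ici_self
  -- `f` is Lipschitz on the compact set swept out by the two solutions.
  let S : Set V := y '' Set.Icc a t ∪ z '' Set.Icc a t
  have hS : IsCompact S := (isCompact_Icc.image_of_continuousOn hyc).union
    (isCompact_Icc.image_of_continuousOn hzc)
  have hSU : S ⊆ U := by
    rintro _ (⟨s, hs, rfl⟩ | ⟨s, hs, rfl⟩)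
    exacts [hyU s hs.1, hzU s hs.1]
  have hloc : LocallyLipschitzOn S f := fun v hv => by
    obtain ⟨K, N, hN, hK⟩ := (hf v (hSU hv)).exists_lipschitzOnWith
    exact ⟨K, N, mem_nhdsWithin_of_mem_nhds hN, hK⟩
  obtain ⟨K, hK⟩ := hloc.exists_lipschitzOnWith_of_compact hS
  exact ODE_solution_unique_of_mem_Icc_right (v := fun _ => f) (s := fun _ => S)
    (fun _ _ => hK) hyc (fun s hs => (hy s hs.1).mono (Set.Ici_subset_Ici.2 hs.1))
    (fun s hs => Or.inl ⟨s, Set.Ico_subset_Icc_self hs, rfl⟩) hzc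
    (fun s hs => (hz s hs.1).mono (Set.Ici_subset_Ici.2 hs.1))
    (fun s hs => Or.inr ⟨s, Set.Ico_subset_Icc_self hs, rfl⟩) ha ⟨ht, le_rfl⟩

end Uniqueness

section MatrixInverse

variable {𝕜 E ι : Type*} [NontriviallyNormedField 𝕜] [NormedAddCommGroup E] [NormedSpace 𝕜 E]
  [Fintype ι] [DecidableEq ι] {n : WithTop ℕ∞} {f : E → Matrix ι ι 𝕜} {x : E}

lemma contDiffAt_matrix_det (hf : ∀ i j, ContDiffAt 𝕜 n (fun y => f y i j) x) :
    ContDiffAt 𝕜 n (fun y => (f y).det) x := by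
  simp only [Matrix.det_apply]
  exact ContDiffAt.sum fun σ _ => (contDiffAt_prod fun i _ => hf (σ i) i).const_smul _

lemma contDiffAt_matrix_inv_apply (hf : ∀ i j, ContDiffAt 𝕜 n (fun y => f y i j) x)
    (hx : (f x).det ≠ 0) (i j : ι) : ContDiffAt 𝕜 n (fun y => (f y)⁻¹ i j) x := by
  have hadj : ContDiffAt 𝕜 n (fun y => (f y).adjugate i j) x := by
    simp only [Matrix.adjugate_apply]
    refine contDiffAt_matrix_det fun k l => ?_
    rcases eq_or_ne k j with rfl | hk
    · simpa only [Matrix.updateRow_self] using contDiffAt_const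
    · simpa only [Matrix.updateRow_ne hk] using hf k l
  simp only [Matrix.inv_def, Ring.inverse_eq_inv', Matrix.smul_apply, smul_eq_mul]
  exact ((contDiffAt_matrix_det hf).inv hx).mul hadj

end MatrixInverse

section RicciFlowField

variable (c : Fin 3 → Fin 3 → Fin 3 → ℝ) {p : Fin 3 → Fin 3 → ℝ}

/-- The right-hand side `-2 Ric` of the Ricci flow, as a vector field on the space of matrices of
constant metric components in a frame with structure constants `c`. -/
def ricciFlowField (p : Fin 3 → Fin 3 → ℝ) : Fin 3 → Fin 3 → ℝ :=
  fun i j => -2 * ricciConst c (Matrix.of p) i j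

lemma contDiffAt_christoffelConst {n : WithTop ℕ∞} (hp : (Matrix.of p).det ≠ 0) (i j k : Fin 3) :
    ContDiffAt ℝ n (fun q => christoffelConst c (Matrix.of q) i j k) p := by
  have hkoszul : ∀ l, ContDiff ℝ n
      (fun q : Fin 3 → Fin 3 → ℝ => koszulConst c (Matrix.of q) i j l) := fun l => by
    simp only [koszulConst, Matrix.of_apply]
    fun_prop
  have hinv : ∀ l, ContDiffAt ℝ n (fun q : Fin 3 → Fin 3 → ℝ => (Matrix.of q)⁻¹ l k) p := fun l =>
    contDiffAt_matrix_inv_apply (fun i j => by simp only [Matrix.of_apply]; fun_prop) hp l k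
  exact ContDiffAt.sum fun l _ => (hkoszul l).contDiffAt.mul (hinv l)

lemma contDiffAt_ricciFlowField {n : WithTop ℕ∞} (hp : (Matrix.of p).det ≠ 0) :
    ContDiffAt ℝ n (ricciFlowField c) p := by
  have h := contDiffAt_christoffelConst c (n := n) hp
  refine contDiffAt_pi.2 fun j => contDiffAt_pi.2 fun k => ?_
  simp only [ricciFlowField, ricciConst]
  fun_prop

end RicciFlowField

/-! ### The Ricci flow of Berger metrics -/

section Separable

lemma exists_hasDerivAt_div {Φ φ : ℝ → ℝ} (hmono : StrictMono Φ) (hsurj : Function.Surjective Φ)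
    (hΦ : ∀ x, HasDerivAt Φ (φ x) x) (k a : ℝ) :
    ∃ θ : ℝ → ℝ, (∀ t, Φ (θ t) = Φ a + k * t) ∧
      ∀ t, φ (θ t) ≠ 0 → HasDerivAt θ (k / φ (θ t)) t := by
  let Ψ : ℝ ≃o ℝ := hmono.orderIsoOfSurjective Φ hsurj
  have hΨ : ∀ y, Φ (Ψ.symm y) = y := Ψ.apply_symm_apply
  refine ⟨fun t => Ψ.symm (Φ a + k * t), fun t => hΨ _, fun t ht => ?_⟩
  have hsymm : HasDerivAt Ψ.symm (φ (Ψ.symm (Φ a + k * t)))⁻¹ (Φ a + k * t) :=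
    (hΦ _).of_local_left_inverse Ψ.symm.continuous.continuousAt ht (.of_forall hΨ)
  have hlin : HasDerivAt (fun s => Φ a + k * s) k t := by
    simpa using ((hasDerivAt_id t).const_mul k).const_add (Φ a)
  exact (hsymm.comp t hlin).congr_deriv (div_eq_inv_mul k _).symm

lemma tendsto_sinh_sub_id : Filter.Tendsto (fun x => Real.sinh x - x) .atTop .atTop := by
  refine Filter.tendsto_atTop_mono' _ ?_ Filter.tendsto_id
  filter_upwards [Filter.eventually_ge_atTop 6] with x hx
  have hexp := Real.quadratic_le_exp_of_nonneg (by linarith : 0 ≤ x)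
  have hexp_neg : Real.exp (-x) ≤ 1 := Real.exp_le_one_iff.2 (by linarith)
  rw [id, Real.sinh_eq]
  nlinarith

lemma surjective_sinh_sub_id : Function.Surjective fun x : ℝ => Real.sinh x - x := by
  refine (Real.continuous_sinh.sub continuous_id).surjective tendsto_sinh_sub_id ?_
  refine (Filter.tendsto_neg_atTop_atBot.comp
    (tendsto_sinh_sub_id.comp Filter.tendsto_neg_atBot_atTop)).congr fun x => ?_
  simp only [Function.comp_apply, Real.sinh_neg, Pi.sub_apply, id]
  ring

lemma exists_hasDerivAt_div_cosh_sub_one {k a : ℝ} (hk : 0 ≤ k) (ha : 0 < a) :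
    ∃ ψ : ℝ → ℝ, ψ 0 = a ∧ ∀ t, 0 ≤ t →
      0 < ψ t ∧ HasDerivAt ψ (k / (Real.cosh (ψ t) - 1)) t := by
  have hmono := Real.sinh_sub_id_strictMono
  obtain ⟨ψ, hψ, hψ'⟩ := exists_hasDerivAt_div hmono surjective_sinh_sub_id
    (fun x => (Real.hasDerivAt_sinh x).fun_sub (hasDerivAt_id' x)) k a
  refine ⟨ψ, hmono.injective (by simp only [hψ, mul_zero, add_zero]), fun t ht => ?_⟩
  have hpos : 0 < ψ t := ha.trans_le <| hmono.le_iff_le.1 <| by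
    simp only [hψ]
    linarith [mul_nonneg hk ht]
  exact ⟨hpos, hψ' t (sub_pos.2 (Real.one_lt_cosh.2 hpos.ne')).ne'⟩

end Separable

/-- `A` and `B` are positive and solve, for `t ≥ 0`, the system `A' = -2 R_{00}`, `B' = -2 R_{11}`
of the Ricci flow of the metrics with components `diagonal ![A, B, B]` in a Milnor frame with
`λ = (-1, 1, 1)`. At `t = 0` the derivative is two-sided, which costs nothing since the solutions
extend to slightly negative times. -/
structure IsBergerFlow (A B : ℝ → ℝ) : Prop where
  left_pos : ∀ t, 0 ≤ t → 0 < A t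
  right_pos : ∀ t, 0 ≤ t → 0 < B t
  hasDerivAt_left : ∀ t, 0 ≤ t → HasDerivAt A (-2 * (2 * A t ^ 2 / B t ^ 2)) t
  hasDerivAt_right : ∀ t, 0 ≤ t → HasDerivAt B (-2 * (-4 - 2 * A t / B t)) t

/-- The ratio of the equations is homogeneous, so the orbits can be integrated explicitly: they are
`A = 2 c sinh ψ / (cosh ψ - 1)`, `B = c sinh ψ`. -/
lemma isBergerFlow_of_hasDerivAt {ψ : ℝ → ℝ} {c : ℝ} (hc : 0 < c) (hψ : ∀ t, 0 ≤ t →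
      0 < ψ t ∧ HasDerivAt ψ (8 / c / (Real.cosh (ψ t) - 1)) t) :
    IsBergerFlow (fun t => 2 * c * Real.sinh (ψ t) / (Real.cosh (ψ t) - 1))
      (fun t => c * Real.sinh (ψ t)) := by
  have hsinh : ∀ t, 0 ≤ t → 0 < Real.sinh (ψ t) := fun t ht => Real.sinh_pos_iff.2 (hψ t ht).1
  have hcosh : ∀ t, 0 ≤ t → 0 < Real.cosh (ψ t) - 1 := fun t ht =>
    sub_pos.2 (Real.one_lt_cosh.2 (hψ t ht).1.ne')
  refine ⟨fun t ht => ?_, fun t ht => ?_, fun t ht => ?_, fun t ht => ?_⟩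
  · have := hsinh t ht
    have := hcosh t ht
    positivity
  · have := hsinh t ht
    positivity
  · have hs := (hsinh t ht).ne'
    have hu := (hcosh t ht).ne'
    have hd := (hψ t ht).2
    refine ((hd.sinh.const_mul (2 * c)).div (hd.cosh.sub_const 1) hu).congr_deriv ?_
    field_simp
    linear_combination 8 * Real.cosh_sq (ψ t)
  · have hs := (hsinh t ht).ne'
    have hu := (hcosh t ht).ne'
    refine ((hψ t ht).2.sinh.const_mul c).congr_deriv ?_
    field_simp
    ring

lemma exists_isBergerFlow {A₀ B₀ : ℝ} (hA : 0 < A₀) (hB : 0 < B₀) :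
    ∃ A B : ℝ → ℝ, A 0 = A₀ ∧ B 0 = B₀ ∧ IsBergerFlow A B := by
  have hone : 1 < 1 + 2 * B₀ / A₀ := lt_add_of_pos_right 1 (by positivity)
  let a : ℝ := Real.arcosh (1 + 2 * B₀ / A₀)
  have ha : 0 < a := Real.arcosh_pos hone
  have hcosh : Real.cosh a = 1 + 2 * B₀ / A₀ := Real.cosh_arcosh hone.le
  have hsinh : 0 < Real.sinh a := Real.sinh_pos_iff.2 ha
  have hc : 0 < B₀ / Real.sinh a := div_pos hB hsinh
  obtain ⟨ψ, hψ₀, hψ⟩ := exists_hasDerivAt_div_cosh_sub_one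
    (k := 8 / (B₀ / Real.sinh a)) (by positivity) ha
  refine ⟨_, _, ?_, ?_, isBergerFlow_of_hasDerivAt hc hψ⟩
  · simp only [hψ₀, hcosh]
    field_simp
    ring
  · simp only [hψ₀]
    field_simp

namespace IsBergerFlow

variable {A B : ℝ → ℝ}

lemma hasDerivAt_div (h : IsBergerFlow A B) {t : ℝ} (ht : 0 ≤ t) :
    HasDerivAt (fun s => A s / B s) (-8 * (A t / B t) * (1 + A t / B t) / B t) t := by
  have hB := (h.right_pos t ht).ne'
  refine ((h.hasDerivAt_left t ht).div (h.hasDerivAt_right t ht) hB).congr_deriv ?_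
  field_simp
  ring

lemma strictAntiOn_div (h : IsBergerFlow A B) : StrictAntiOn (fun t => A t / B t) (Set.Ici 0) := by
  refine strictAntiOn_of_deriv_neg (convex_Ici 0)
    (fun t ht => (h.hasDerivAt_div ht).continuousAt.continuousWithinAt) fun t ht => ?_
  have ht' : 0 ≤ t := interior_subset ht
  have hA := h.left_pos t ht'
  have hB := h.right_pos t ht'
  rw [(h.hasDerivAt_div ht').deriv, neg_mul, neg_mul, neg_div, neg_lt_zero]
  positivity

lemma antitoneOn_left (h : IsBergerFlow A B) : AntitoneOn A (Set.Ici 0) := by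
  refine antitoneOn_of_hasDerivWithinAt_nonpos (convex_Ici 0)
    (fun t ht => (h.hasDerivAt_left t ht).continuousAt.continuousWithinAt)
    (fun t ht => (h.hasDerivAt_left t (interior_subset ht)).hasDerivWithinAt) fun t _ => ?_
  rw [neg_mul, neg_nonpos]
  positivity

lemma monotoneOn_right_sub (h : IsBergerFlow A B) :
    MonotoneOn (fun t => B t - 8 * t) (Set.Ici 0) := by
  have hderiv : ∀ t, 0 ≤ t → HasDerivAt (fun t => B t - 8 * t) (4 * (A t / B t)) t := fun t ht =>
    ((h.hasDerivAt_right t ht).sub ((hasDerivAt_id t).const_mul 8)).congr_deriv (by ring)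
  refine monotoneOn_of_hasDerivWithinAt_nonneg (convex_Ici 0)
    (fun t ht => (hderiv t ht).continuousAt.continuousWithinAt)
    (fun t ht => (hderiv t (interior_subset ht)).hasDerivWithinAt) fun t ht => ?_
  have hA := h.left_pos t (interior_subset ht)
  have hB := h.right_pos t (interior_subset ht)
  positivity

lemma tendsto_div (h : IsBergerFlow A B) :
    Filter.Tendsto (fun t => A t / B t) Filter.atTop (𝓝 0) := by
  have hlim : Filter.Tendsto (fun t : ℝ => A 0 / (8 * t)) Filter.atTop (𝓝 0) :=
    tendsto_const_nhds.div_atTop (Filter.tendsto_id.const_mul_atTop (by norm_num))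
  refine squeeze_zero' ?_ ?_ hlim
  · filter_upwards [Filter.eventually_ge_atTop 0] with t ht
    exact (div_pos (h.left_pos t ht) (h.right_pos t ht)).le
  · filter_upwards [Filter.eventually_gt_atTop 0] with t ht
    have hA : A t ≤ A 0 := h.antitoneOn_left Set.self_mem_Ici ht.le ht.le
    have hB : B 0 - 8 * 0 ≤ B t - 8 * t := h.monotoneOn_right_sub Set.self_mem_Ici ht.le ht.le
    have hB₀ := h.right_pos 0 le_rfl
    exact div_le_div₀ (h.left_pos 0 le_rfl).le hA (by positivity) (by linarith)

end IsBergerFlow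

/-! ### Left-invariant vector fields and metrics -/

section InvariantVectorField

variable {𝕜 : Type*} [NontriviallyNormedField 𝕜] {H : Type*} [TopologicalSpace H]
  {E : Type*} [NormedAddCommGroup E] [NormedSpace 𝕜 E] {I : ModelWithCorners 𝕜 E H}
  {G : Type*} [TopologicalSpace G] [ChartedSpace H G] [Group G] [LieGroup I ∞ G]

lemma contMDiff_invariantField (v : GroupLieAlgebra I G) :
    ContMDiff I I.tangent ∞ (fun x : G => (mulInvariantVectorField v x : TangentBundle I G)) := by
  intro x
  have hmul : ContMDiffAt (I.prod I) I ∞ (Function.uncurry fun a b : G => a * b) (x, 1) :=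
    contMDiff_mul I ∞ (x, 1)
  have hderiv := hmul.mfderiv (m := ∞) (fun a b : G => a * b) (fun _ => 1) contMDiffAt_const le_rfl
  have hmul_one : ContMDiffAt I I ∞ (fun y : G => y * 1) x := by
    simp only [mul_one]
    exact contMDiffAt_id
  have hconst : ContMDiffAt I I.tangent ∞ (fun _ : G => (⟨1, v⟩ : TangentBundle I G)) x :=
    contMDiffAt_const
  refine (hderiv.clm_apply_of_inCoordinates hconst hmul_one).congr_of_eventuallyEq ?_
  exact .of_forall fun y => Bundle.TotalSpace.ext (mul_one y).symm HEq.rfl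

lemma mfderiv_mul_left_invariantField (v : GroupLieAlgebra I G) (a x : G) :
    mfderiv I I (fun y : G => a * y) x (mulInvariantVectorField v x) =
      mulInvariantVectorField v (a * x) := by
  have hdiff (b y : G) : MDifferentiableAt I I (fun z : G => b * z) y :=
    (contMDiff_mul_left (I := I) (n := ∞)).mdifferentiableAt (by simp)
  have ha : HasMFDerivAt I I (fun z : G => a * z) (x * 1) (mfderiv I I (fun z : G => a * z) x) := by
    rw [mul_one]
    exact (hdiff a x).hasMFDerivAt
  have hcomp := (ha.comp 1 (hdiff x 1).hasMFDerivAt).mfderiv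
  rw [show (fun z : G => a * z) ∘ (fun z : G => x * z) = fun z => a * x * z from
    funext fun z => (mul_assoc a x z).symm] at hcomp
  exact (DFunLike.congr_fun hcomp v).symm

end InvariantVectorField

section LieGroup

variable {G : Type*} [TopologicalSpace G] [ChartedSpace E3 G] [Group G] [LieGroup (𝓡 3) ∞ G]
  {e : Module.Basis (Fin 3) ℝ (GroupLieAlgebra (𝓡 3) G)} {g : Metric G}

lemma lieGroup_minSmoothness : LieGroup (𝓡 3) (minSmoothness ℝ 3) G := by
  rw [minSmoothness_of_isRCLikeNormedField]
  infer_instance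

lemma bracket_mulInvariantVectorField (v w : GroupLieAlgebra (𝓡 3) G) :
    bracket (mulInvariantVectorField v) (mulInvariantVectorField w) =
      mulInvariantVectorField ⁅v, w⁆ := by
  have := lieGroup_minSmoothness (G := G)
  exact (mulInvariantVector_mlieBracket v w).symm

lemma bracket_frame {lam mu nu : ℝ} (he : MilnorRelations e lam mu nu) (i j : Fin 3) :
    bracket (frame e i) (frame e j) = ∑ k, milnorConst ![lam, mu, nu] i j k • frame e k := by
  have := lieGroup_minSmoothness (G := G)
  have h₂₁ : ⁅e 2, e 1⁆ = -((2 * lam) • e 0) := by rw [← he.rel1, lie_skew]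
  have h₀₂ : ⁅e 0, e 2⁆ = -((2 * mu) • e 1) := by rw [← he.rel2, lie_skew]
  have h₁₀ : ⁅e 1, e 0⁆ = -((2 * nu) • e 2) := by rw [← he.rel3, lie_skew]
  have hlie : ⁅e i, e j⁆ = ∑ k, milnorConst ![lam, mu, nu] i j k • e k := by
    fin_cases i <;> fin_cases j <;>
      simp [Fin.sum_univ_three, milnorConst, eta_eq, he.rel1, he.rel2, he.rel3, h₂₁, h₀₂, h₁₀]
  simp only [frame, bracket_mulInvariantVectorField, hlie, Fin.sum_univ_three,
    mulInvariantVectorField_add, mulInvariantVectorField_smul]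

lemma IsLeftInvariant.inner_frame (hg : IsLeftInvariant g) (x : G) (i j : Fin 3) :
    g.inner x (frame e i x) (frame e j x) = g.inner 1 (e i) (e j) := by
  have h := hg x 1 (e i) (e j)
  rw [mul_one] at h
  exact h

lemma IsLeftInvariant.gram_eq (hg : IsLeftInvariant g) (x y : G) :
    gram g (frame e) x = gram g (frame e) y := by
  ext i j
  exact (hg.inner_frame x i j).trans (hg.inner_frame y i j).symm

lemma IsLeftInvariant.hasConstantComponents (hg : IsLeftInvariant g) {lam mu nu : ℝ}
    (he : MilnorRelations e lam mu nu) :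
    HasConstantComponents g (frame e) (milnorConst ![lam, mu, nu]) (gram g (frame e) 1) where
  gram_eq x := hg.gram_eq x 1
  bracket_eq := bracket_frame he

end LieGroup

section RankOnePerturbation

variable {E : Type*} [NormedAddCommGroup E] [NormedSpace ℝ E] {H : Type*} [TopologicalSpace H]
  {I : ModelWithCorners ℝ E H} {n : WithTop ℕ∞} {M : Type*} [TopologicalSpace M]
  [ChartedSpace H M] [IsManifold I 1 M]
  (g : ContMDiffRiemannianMetric I n E (fun x : M => TangentSpace I x))

lemma inner_self_nonneg_of_metric {x : M} (v : TangentSpace I x) : 0 ≤ g.inner x v v := by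
  rcases eq_or_ne v 0 with rfl | hv
  · simp
  · exact (g.pos x v hv).le

lemma sq_inner_le_of_metric {x : M} (u v : TangentSpace I x) :
    g.inner x u v ^ 2 ≤ g.inner x u u * g.inner x v v := by
  rcases eq_or_ne u 0 with rfl | hu
  · simp
  have hpos := g.pos x u hu
  have hnonneg := inner_self_nonneg_of_metric g (g.inner x u u • v - g.inner x u v • u)
  simp only [map_sub, map_smul, FunLike.coe_sub, FunLike.coe_smul, Pi.sub_apply, Pi.smul_apply,
    smul_eq_mul, g.symm x v u] at hnonneg
  nlinarith

lemma min_mul_inner_le_inner_add {x : M} (u v : TangentSpace I x) (β : ℝ) :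
    min 1 (1 + β * g.inner x u u) * g.inner x v v ≤ g.inner x v v + β * g.inner x u v ^ 2 := by
  have hv := inner_self_nonneg_of_metric g v
  have hsq := sq_inner_le_of_metric g u v
  rcases le_total 0 β with hβ | hβ
  · have := mul_le_mul_of_nonneg_right (min_le_left 1 (1 + β * g.inner x u u)) hv
    linarith [mul_nonneg hβ (sq_nonneg (g.inner x u v))]
  · have := mul_le_mul_of_nonneg_right (min_le_right 1 (1 + β * g.inner x u u)) hv
    linarith [mul_le_mul_of_nonpos_left hsq hβ]

lemma contMDiff_inner_left {X : (x : M) → TangentSpace I x}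
    (hX : ContMDiff I I.tangent n (fun x => (X x : TangentBundle I M))) :
    ContMDiff I (I.prod 𝓘(ℝ, E →L[ℝ] ℝ)) n (fun x => TotalSpace.mk' (E →L[ℝ] ℝ)
      (E := fun x : M => TangentSpace I x →L[ℝ] Bundle.Trivial M ℝ x) x (g.inner x (X x))) :=
  ContMDiff.clm_bundle_apply (F₁ := E) (F₂ := E →L[ℝ] ℝ) (E₁ := TangentSpace I)
    (E₂ := fun x : M => TangentSpace I x →L[ℝ] Bundle.Trivial M ℝ x) (b := fun x => x)
    g.contMDiff hX

lemma contMDiff_smulRight_self {φ : ∀ x : M, TangentSpace I x →L[ℝ] ℝ}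
    (hφ : ContMDiff I (I.prod 𝓘(ℝ, E →L[ℝ] ℝ)) n (fun x => TotalSpace.mk' (E →L[ℝ] ℝ)
      (E := fun x : M => TangentSpace I x →L[ℝ] Bundle.Trivial M ℝ x) x (φ x))) :
    ContMDiff I (I.prod 𝓘(ℝ, E →L[ℝ] E →L[ℝ] ℝ)) n (fun x => TotalSpace.mk' (E →L[ℝ] E →L[ℝ] ℝ)
      (E := fun x : M => TangentSpace I x →L[ℝ] TangentSpace I x →L[ℝ] Bundle.Trivial M ℝ x)
      x ((φ x).smulRight (φ x))) := by
  intro x₀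
  rw [contMDiffAt_hom_bundle]
  refine ⟨contMDiffAt_id, ?_⟩
  have hcoord := ((contMDiffAt_hom_bundle _).1 (hφ x₀)).2
  have hquad : ContDiff ℝ n (fun q : E →L[ℝ] ℝ => q.smulRight q) := by fun_prop
  refine (hquad.contMDiff.contMDiffAt.comp x₀ hcoord).congr_of_eventuallyEq ?_
  filter_upwards [(trivializationAt E (TangentSpace I) x₀).open_baseSet.mem_nhds
    (FiberBundle.mem_baseSet_trivializationAt E (TangentSpace I) x₀)] with x hx
  ext v w
  rw [inCoordinates_apply_eq₂ hx hx (by simp)]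
  simp [ContinuousLinearMap.inCoordinates_eq hx]

/-- The metric `g + β θ ⊗ θ` for the one-form `θ = g(X, ·)`, which is again positive definite when
`1 + β g(X, X) > 0`. It is used to rescale a metric in one direction of an orthogonal frame. -/
def addRankOne {X : (x : M) → TangentSpace I x}
    (hX : ContMDiff I I.tangent n (fun x => (X x : TangentBundle I M))) {β : ℝ}
    (hβ : ∀ x, 0 < 1 + β * g.inner x (X x) (X x)) :
    ContMDiffRiemannianMetric I n E (fun x : M => TangentSpace I x) where
  inner x := g.inner x + β • (g.inner x (X x)).smulRight (g.inner x (X x))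
  symm x v w := by
    simp only [add_apply, smul_apply, ContinuousLinearMap.smulRight_apply, smul_eq_mul,
      g.symm x v w]
    ring
  pos x v hv := by
    have hle := min_mul_inner_le_inner_add g (X x) v β
    have hpos := mul_pos (lt_min one_pos (hβ x)) (g.pos x v hv)
    simp only [add_apply, smul_apply, ContinuousLinearMap.smulRight_apply, smul_eq_mul]
    linarith
  isVonNBounded x := by
    set m := min 1 (1 + β * g.inner x (X x) (X x))
    have hm : 0 < √m := Real.sqrt_pos.2 (lt_min one_pos (hβ x))
    refine ((g.isVonNBounded x).image
      ((√m)⁻¹ • ContinuousLinearMap.id ℝ (TangentSpace I x))).subset fun v hv => ?_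
    refine ⟨√m • v, ?_, by simp [smul_smul, hm.ne']⟩
    have hle := min_mul_inner_le_inner_add g (X x) v β
    have hsq : √m * (√m * g.inner x v v) = m * g.inner x v v := by
      rw [← mul_assoc, Real.mul_self_sqrt (Real.sqrt_pos.1 hm).le]
    simp only [Set.mem_ofPred_eq, add_apply, smul_apply, ContinuousLinearMap.smulRight_apply,
      smul_eq_mul, map_smul] at hv ⊢
    linarith
  contMDiff := by
    have hg := g.contMDiff
    have hθ := contMDiff_smulRight_self (contMDiff_inner_left g hX)
    have (x : M) : ContinuousAdd (TangentSpace I x →L[ℝ] Bundle.Trivial M ℝ x) :=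
      inferInstanceAs (ContinuousAdd (E →L[ℝ] ℝ))
    exact hg.add_section (hθ.const_smul_section (a := β))

end RankOnePerturbation

section LieGroup

variable {G : Type*} [TopologicalSpace G] [ChartedSpace E3 G] [Group G] [LieGroup (𝓡 3) ∞ G]
  {e : Module.Basis (Fin 3) ℝ (GroupLieAlgebra (𝓡 3) G)} {g : Metric G}

lemma IsLeftInvariant.addRankOne (hg : IsLeftInvariant g) (v : GroupLieAlgebra (𝓡 3) G) {β : ℝ}
    (hβ : ∀ x, 0 < 1 + β * g.inner x (mulInvariantVectorField v x) (mulInvariantVectorField v x)) :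
    IsLeftInvariant (addRankOne g (contMDiff_invariantField v) hβ) := by
  intro a x u w
  have hθ (u : TangentSpace (𝓡 3) x) :
      g.inner (a * x) (mulInvariantVectorField v (a * x))
        (mfderiv (𝓡 3) (𝓡 3) (fun y : G => a * y) x u) =
      g.inner x (mulInvariantVectorField v x) u := by
    rw [← mfderiv_mul_left_invariantField, hg a x]
  simp only [CottonYork.addRankOne, add_apply, smul_apply, ContinuousLinearMap.smulRight_apply, hθ,
    hg a x]

lemma IsLeftInvariant.exists_gram_eq_diagonal_update (hg : IsLeftInvariant g) {d : Fin 3 → ℝ}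
    (hgram : ∀ x, gram g (frame e) x = Matrix.diagonal d) {i : Fin 3} (hd : 0 < d i) {a : ℝ}
    (ha : 0 < a) :
    ∃ g' : Metric G, IsLeftInvariant g' ∧
      ∀ x, gram g' (frame e) x = Matrix.diagonal (Function.update d i a) := by
  have hinner (x : G) (j k : Fin 3) :
      g.inner x (frame e j x) (frame e k x) = Matrix.diagonal d j k := congrFun₂ (hgram x) j k
  have hβ (x : G) : 0 < 1 + (a - d i) / d i ^ 2 * g.inner x (frame e i x) (frame e i x) := by
    rw [hinner, Matrix.diagonal_apply_eq, show 1 + (a - d i) / d i ^ 2 * d i = a / d i by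
      field_simp; ring]
    positivity
  refine ⟨_, hg.addRankOne (e i) hβ, fun x => ?_⟩
  ext j k
  change g.inner x (frame e j x) (frame e k x) + (a - d i) / d i ^ 2 *
    (g.inner x (frame e i x) (frame e j x) * g.inner x (frame e i x) (frame e k x)) = _
  have hβi : d i + (a - d i) / d i ^ 2 * (d i * d i) = a := by field_simp; ring
  simp only [hinner, Matrix.diagonal_apply, Function.update_apply]
  rcases eq_or_ne i j with rfl | hij
  · rcases eq_or_ne i k with rfl | hik
    · simpa only [if_true] using hβi
    · simp [hik]
  · simp [hij, hij.symm]

lemma IsLeftInvariant.exists_gram_eq_diagonal (hg : IsLeftInvariant g) {d d' : Fin 3 → ℝ}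
    (hgram : ∀ x, gram g (frame e) x = Matrix.diagonal d) (hd : ∀ i, 0 < d i)
    (hd' : ∀ i, 0 < d' i) :
    ∃ g' : Metric G, IsLeftInvariant g' ∧ ∀ x, gram g' (frame e) x = Matrix.diagonal d' := by
  obtain ⟨g₁, hg₁, hgram₁⟩ := hg.exists_gram_eq_diagonal_update hgram (hd 0) (hd' 0)
  obtain ⟨g₂, hg₂, hgram₂⟩ := hg₁.exists_gram_eq_diagonal_update hgram₁ (i := 1) (hd 1) (hd' 1)
  obtain ⟨g₃, hg₃, hgram₃⟩ := hg₂.exists_gram_eq_diagonal_update hgram₂ (i := 2) (hd 2) (hd' 2)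
  refine ⟨g₃, hg₃, fun x => (hgram₃ x).trans (congrArg _ ?_)⟩
  ext i
  fin_cases i <;> rfl

end LieGroup

/-! ### Comparison of volume measures -/

section Gram

variable {M : Type*} [TopologicalSpace M] [ChartedSpace E3 M] [IsManifold (𝓡 3) ∞ M]
  (g : Metric M) {F : Fin 3 → VField M} {x : M}

lemma vecMul_gram (a : Fin 3 → ℝ) (j : Fin 3) :
    Matrix.vecMul a (gram g F x) j = g.inner x (∑ i, a i • F i x) (F j x) := by
  simp [Matrix.vecMul, dotProduct, gram, pair]

lemma vecMul_gram_eq_zero_iff (a : Fin 3 → ℝ) :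
    Matrix.vecMul a (gram g F x) = 0 ↔ ∑ i, a i • F i x = 0 := by
  refine ⟨fun h => ?_, fun h => ?_⟩
  · have hself : g.inner x (∑ i, a i • F i x) (∑ j, a j • F j x) = 0 := by
      rw [map_sum]
      refine Finset.sum_eq_zero fun j _ => ?_
      rw [map_smul, ← vecMul_gram, h, Pi.zero_apply, smul_zero]
    by_contra hne
    exact (g.pos x _ hne).ne' hself
  · ext j
    rw [vecMul_gram, h, map_zero]
    rfl

lemma det_gram_ne_zero_iff : (gram g F x).det ≠ 0 ↔ LinearIndependent ℝ (fun i => F i x) := by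
  rw [Ne, ← Matrix.exists_vecMul_eq_zero_iff, Fintype.linearIndependent_iff]
  simp only [vecMul_gram_eq_zero_iff, ne_eq, not_exists, not_and', not_not]
  exact forall₂_congr fun a _ => funext_iff

lemma exists_eq_sum_smul {K V ι : Type*} [DivisionRing K] [AddCommGroup V] [Module K V]
    [FiniteDimensional K V] [Fintype ι] {u : ι → V} (hu : LinearIndependent K u)
    (hcard : Fintype.card ι = Module.finrank K V) (v : V) : ∃ a : ι → K, v = ∑ i, a i • u i := by
  have hspan := hu.span_eq_top_of_card_eq_finrank' hcard
  obtain ⟨a, ha⟩ :=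
    (Submodule.mem_span_range_iff_exists_fun K).1 (hspan.ge (Submodule.mem_top (x := v)))
  exact ⟨a, ha.symm⟩

lemma det_inner_sum_smul {ι : Type*} [Fintype ι] [DecidableEq ι] (u : ι → TangentSpace (𝓡 3) x)
    (J : Matrix ι ι ℝ) :
    (Matrix.of fun i j => g.inner x (∑ k, J k i • u k) (∑ l, J l j • u l)).det =
      J.det ^ 2 * (Matrix.of fun i j => g.inner x (u i) (u j)).det := by
  have hmul : (Matrix.of fun i j => g.inner x (∑ k, J k i • u k) (∑ l, J l j • u l)) =
      J.transpose * (Matrix.of fun i j => g.inner x (u i) (u j)) * J := by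
    ext i j
    simp only [Matrix.of_apply, Matrix.mul_apply, Matrix.transpose_apply, map_sum, map_smul,
      _root_.sum_apply, smul_apply, smul_eq_mul]
    exact Finset.sum_congr rfl fun l _ => mul_comm _ _
  rw [hmul, Matrix.det_mul, Matrix.det_mul, Matrix.det_transpose]
  ring

lemma volDensity_mul_sqrt_det_gram (h : Metric M) {e : OpenPartialHomeomorph M E3} {y : E3}
    (hF : LinearIndependent ℝ (fun i => F i (e.symm y))) :
    volDensity g e y * √(gram h F (e.symm y)).det =
      volDensity h e y * √(gram g F (e.symm y)).det := by
  have : FiniteDimensional ℝ (TangentSpace (𝓡 3) (e.symm y)) :=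
    inferInstanceAs (FiniteDimensional ℝ E3)
  have hrank : Module.finrank ℝ (TangentSpace (𝓡 3) (e.symm y)) = 3 := finrank_euclideanSpace_fin
  choose a ha using fun i =>
    exists_eq_sum_smul hF (by rw [hrank, Fintype.card_fin]) (coordVec e i y)
  have hdensity (k : Metric M) : volDensity k e y =
      |(Matrix.of fun j i => a i j).det| * √(gram k F (e.symm y)).det := by
    have hdet := det_inner_sum_smul k (fun i => F i (e.symm y)) (Matrix.of fun j i => a i j)
    simp only [Matrix.of_apply, ← ha] at hdet
    rw [volDensity, hdet, Real.sqrt_mul (sq_nonneg _), Real.sqrt_sq_eq_abs]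
    rfl
  rw [hdensity g, hdensity h]
  ring

lemma iSup_smul_measure {α ι : Type*} [MeasurableSpace α] {c : ENNReal} (hc : c ≠ 0)
    (hc' : c ≠ ⊤) (μ : ι → Measure α) : ⨆ i, c • μ i = c • ⨆ i, μ i := by
  refine le_antisymm (iSup_le fun i => smul_le_smul_left c (le_iSup μ i)) ?_
  have hle : ⨆ i, μ i ≤ c⁻¹ • ⨆ i, c • μ i := iSup_le fun i => by
    have h := smul_le_smul_left c⁻¹ (le_iSup (fun i => c • μ i) i)
    rwa [smul_smul, ENNReal.inv_mul_cancel hc hc', one_smul] at h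
  have h := smul_le_smul_left c hle
  rwa [smul_smul, ENNReal.mul_inv_cancel hc hc', one_smul] at h

lemma riemVolume_eq_smul [MeasurableSpace M] (h : Metric M) {r : ℝ} (hr : 0 < r)
    (hdensity : ∀ x y, volDensity g (chartAt E3 x) y = r * volDensity h (chartAt E3 x) y) :
    riemVolume g = ENNReal.ofReal r • riemVolume h := by
  have hchart (x : M) : chartVolume g (chartAt E3 x) =
      ENNReal.ofReal r • chartVolume h (chartAt E3 x) := by
    have hfun : (fun y => ENNReal.ofReal (volDensity g (chartAt E3 x) y)) =
        ENNReal.ofReal r • fun y => ENNReal.ofReal (volDensity h (chartAt E3 x) y) := by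
      ext y
      rw [hdensity, ENNReal.ofReal_mul hr.le, Pi.smul_apply, smul_eq_mul]
    rw [chartVolume, hfun, withDensity_smul' _ _ ENNReal.ofReal_ne_top, Measure.map_smul,
      chartVolume]
  simp only [riemVolume, hchart]
  exact iSup_smul_measure (ENNReal.ofReal_pos.2 hr).ne' ENNReal.ofReal_ne_top _

lemma riemVolume_eq_sqrt_det_smul [MeasurableSpace M] {h : Metric M} {P : Matrix (Fin 3) (Fin 3) ℝ}
    (hg : ∀ x, gram g F x = P) (hP : 0 < P.det) (hh : ∀ x, gram h F x = 1) :
    riemVolume g = ENNReal.ofReal √P.det • riemVolume h := by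
  refine riemVolume_eq_smul g h (Real.sqrt_pos.2 hP) fun x y => ?_
  have hF : LinearIndependent ℝ (fun i => F i ((chartAt E3 x).symm y)) :=
    (det_gram_ne_zero_iff g).1 (by rw [hg]; exact hP.ne')
  have hcomp := volDensity_mul_sqrt_det_gram g h hF
  rwa [hg, hh, Matrix.det_one, Real.sqrt_one, mul_one, mul_comm (volDensity h _ y)] at hcomp

end Gram

/-! ### Local finiteness of the volume measure -/

section ChangeOfChart

variable {M : Type*} [TopologicalSpace M] [ChartedSpace E3 M] [IsManifold (𝓡 3) ∞ M]
  {e e' : OpenPartialHomeomorph M E3} {y : E3}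

lemma differentiableAt_transition (he : e ∈ atlas E3 M) (he' : e' ∈ atlas E3 M)
    (hy : y ∈ e.target) (hy' : e.symm y ∈ e'.source) : DifferentiableAt ℝ (e' ∘ e.symm) y :=
  mdifferentiableAt_iff_differentiableAt.1 <|
    (mdifferentiableAt_atlas (I := 𝓡 3) he' hy').comp y (mdifferentiableAt_atlas_symm he hy)

lemma mfderiv_symm_eq_comp (he : e ∈ atlas E3 M) (he' : e' ∈ atlas E3 M)
    (hy : y ∈ e.target) (hy' : e.symm y ∈ e'.source) (v : E3) :
    (mfderiv (𝓡 3) (𝓡 3) e.symm y v : E3) =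
      mfderiv (𝓡 3) (𝓡 3) e'.symm (e' (e.symm y)) (fderiv ℝ (e' ∘ e.symm) y v) := by
  have htransition := (differentiableAt_transition he he' hy hy').hasFDerivAt.hasMFDerivAt
  have hsymm' : HasMFDerivAt (𝓡 3) (𝓡 3) e'.symm (e' (e.symm y)) _ :=
    (mdifferentiableAt_atlas_symm he' (e'.map_source hy')).hasMFDerivAt
  have hlocal : e.symm =ᶠ[𝓝 y] e'.symm ∘ (e' ∘ e.symm) := by
    filter_upwards [(e.continuousAt_symm hy).eventually (e'.open_source.mem_nhds hy')] with z hz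
    exact (e'.left_inv hz).symm
  have hcomp := (hsymm'.comp y htransition).congr_of_eventuallyEq hlocal
  exact DFunLike.congr_fun hcomp.mfderiv v

lemma coordVec_eq_sum (he : e ∈ atlas E3 M) (he' : e' ∈ atlas E3 M)
    (hy : y ∈ e.target) (hy' : e.symm y ∈ e'.source) (i : Fin 3) :
    (coordVec e i y : E3) = ∑ k, fderiv ℝ (e' ∘ e.symm) y (EuclideanSpace.single i 1) k •
      (coordVec e' k (e' (e.symm y)) : E3) := by
  have hv := (EuclideanSpace.basisFun (Fin 3) ℝ).sum_repr
    (fderiv ℝ (e' ∘ e.symm) y (EuclideanSpace.single i 1))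
  simp only [EuclideanSpace.basisFun_repr, EuclideanSpace.basisFun_apply] at hv
  have hchain := mfderiv_symm_eq_comp he he' hy hy' (EuclideanSpace.single i 1)
  rw [← hv] at hchain
  refine hchain.trans ?_
  exact (map_sum (mfderiv (𝓡 3) (𝓡 3) e'.symm (e' (e.symm y))) _ _).trans
    (Finset.sum_congr rfl fun k _ => map_smul _ _ _)

lemma volDensity_eq_abs_det_mul (g : Metric M) (he : e ∈ atlas E3 M) (he' : e' ∈ atlas E3 M)
    (hy : y ∈ e.target) (hy' : e.symm y ∈ e'.source) :
    volDensity g e y = |(fderiv ℝ (e' ∘ e.symm) y).det| * volDensity g e' (e' (e.symm y)) := by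
  set φ := fderiv ℝ (e' ∘ e.symm) y
  set b := (EuclideanSpace.basisFun (Fin 3) ℝ).toBasis with hb
  set J := LinearMap.toMatrix b b (φ : E3 →ₗ[ℝ] E3) with hJ
  have hJdet : φ.det = J.det := (LinearMap.det_toMatrix b _).symm
  have hcoord (i : Fin 3) :
      (coordVec e i y : E3) = ∑ k, J k i • (coordVec e' k (e' (e.symm y)) : E3) := by
    have hentry (k : Fin 3) : J k i = φ (EuclideanSpace.single i 1) k := by
      simp [hJ, LinearMap.toMatrix_apply, hb]
    simp only [hentry]
    exact coordVec_eq_sum he he' hy hy' i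
  have hinner {x x' : M} (h : x = x') (v w : E3) : g.inner x v w = g.inner x' v w := by
    rw [h]
  have hgram : (Matrix.of fun i j => g.inner (e.symm y) (coordVec e i y) (coordVec e j y)) =
      Matrix.of fun i j => g.inner (e'.symm (e' (e.symm y)))
        (∑ k, J k i • coordVec e' k (e' (e.symm y)))
        (∑ l, J l j • coordVec e' l (e' (e.symm y))) := by
    ext i j
    refine (hinner (e'.left_inv hy').symm _ _).trans ?_
    rw [hcoord, hcoord]
    rfl
  rw [volDensity, hgram, det_inner_sum_smul, Real.sqrt_mul (sq_nonneg _), Real.sqrt_sq_eq_abs,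
    hJdet]
  rfl

lemma continuousAt_volDensity (g : Metric M) (he : e ∈ atlas E3 M) (hy : y ∈ e.target) :
    ContinuousAt (volDensity g e) y := by
  have hsymm : ContMDiffAt (𝓡 3) (𝓡 3) ∞ e.symm y :=
    contMDiffAt_symm_of_mem_maximalAtlas (IsManifold.subset_maximalAtlas he) hy
  have hcoord (i : Fin 3) : ContMDiffAt (𝓡 3) ((𝓡 3).prod (𝓡 3)) ∞
      (fun z => TotalSpace.mk' E3 (E := TangentSpace (𝓡 3)) (e.symm z) (coordVec e i z)) y :=
    ContMDiffAt.clm_apply_of_inCoordinates (hsymm.mfderiv_const (m := ∞) le_rfl)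
      (contMDiffAt_vectorSpace_iff_contDiffAt.2 contDiffAt_const) hsymm
  have hentry (i j : Fin 3) : ContinuousAt
      (fun z => g.inner (e.symm z) (coordVec e i z) (coordVec e j z)) y := by
    have hsmooth := ContMDiffAt.clm_bundle_apply₂ (F₁ := E3) (F₂ := E3) (F₃ := ℝ)
      (E₃ := Bundle.Trivial M ℝ) (g.contMDiff.contMDiffAt.comp y hsymm) (hcoord i) (hcoord j)
    exact (contMDiffAt_totalSpace.1 hsmooth).2.continuousAt
  exact Real.continuous_sqrt.continuousAt.comp <|
    continuous_id.matrix_det.continuousAt.comp <|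
      continuousAt_pi.2 fun i => continuousAt_pi.2 (hentry i)

end ChangeOfChart

section LocallyFinite

lemma measurableSet_target_inter_preimage {X Y : Type*} [TopologicalSpace X] [TopologicalSpace Y]
    [MeasurableSpace X] [BorelSpace X] [MeasurableSpace Y] [BorelSpace Y]
    (e : OpenPartialHomeomorph X Y) {s : Set X} (hs : MeasurableSet s) :
    MeasurableSet (e.target ∩ e.symm ⁻¹' s) := by
  have hm : Measurable (e.target.domRestrict e.symm) :=
    (continuousOn_iff_continuous_domRestrict.1 e.continuousOn_symm).measurable
  have himage := e.open_target.measurableSet.subtype_image (hm hs)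
  rwa [show (Subtype.val '' (e.target.domRestrict e.symm ⁻¹' s)) = e.target ∩ e.symm ⁻¹' s by
    ext y; simp [and_comm]] at himage

variable {M : Type*} [TopologicalSpace M] [ChartedSpace E3 M] [IsManifold (𝓡 3) ∞ M]
  [MeasurableSpace M] [BorelSpace M] (g : Metric M) {e e' : OpenPartialHomeomorph M E3} {s : Set M}

lemma chartVolume_apply (hs : MeasurableSet s) : chartVolume g e s =
    ∫⁻ y in e.target ∩ e.symm ⁻¹' s, ENNReal.ofReal (volDensity g e y) := by
  have hae : AEMeasurable e.symm ((volume : Measure E3).restrict e.target) :=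
    e.continuousOn_symm.aemeasurable e.open_target.measurableSet
  rw [chartVolume, Measure.map_apply_of_aemeasurable
    (hae.mono_ac (withDensity_absolutelyContinuous _ _)) hs, withDensity_apply',
    Measure.restrict_restrict' e.open_target.measurableSet, Set.inter_comm]

lemma chartVolume_le_of_subset_source (he : e ∈ atlas E3 M) (he' : e' ∈ atlas E3 M)
    (hs : MeasurableSet s) (hs' : s ⊆ e'.source) : chartVolume g e s ≤ chartVolume g e' s := by
  rw [chartVolume_apply g hs, chartVolume_apply g hs]
  set T := e.target ∩ e.symm ⁻¹' s
  have hT : MeasurableSet T := measurableSet_target_inter_preimage e hs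
  have hinj : Set.InjOn (e' ∘ e.symm) T := fun y hy z hz hyz =>
    e.symm.injOn hy.1 hz.1 (e'.injOn (hs' hy.2) (hs' hz.2) hyz)
  have himage : (e' ∘ e.symm) '' T ⊆ e'.target ∩ e'.symm ⁻¹' s := by
    rintro _ ⟨y, hy, rfl⟩
    refine ⟨e'.map_source (hs' hy.2), ?_⟩
    simpa [e'.left_inv (hs' hy.2)] using hy.2
  calc ∫⁻ y in T, ENNReal.ofReal (volDensity g e y)
      = ∫⁻ y in T, ENNReal.ofReal |(fderiv ℝ (e' ∘ e.symm) y).det| *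
          ENNReal.ofReal (volDensity g e' ((e' ∘ e.symm) y)) :=
        setLIntegral_congr_fun hT fun y hy => by
          rw [volDensity_eq_abs_det_mul g he he' hy.1 (hs' hy.2),
            ENNReal.ofReal_mul (abs_nonneg _), Function.comp_apply]
    _ = ∫⁻ z in (e' ∘ e.symm) '' T, ENNReal.ofReal (volDensity g e' z) :=
        (lintegral_image_eq_lintegral_abs_det_fderiv_mul volume hT
          (fun y hy => (differentiableAt_transition he he' hy.1
            (hs' hy.2)).hasFDerivAt.hasFDerivWithinAt) hinj
          fun z => ENNReal.ofReal (volDensity g e' z)).symm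
    _ ≤ _ := lintegral_mono_set himage

lemma riemVolume_le_chartVolume (he : e ∈ atlas E3 M) (hs : MeasurableSet s)
    (hse : s ⊆ e.source) : riemVolume g s ≤ chartVolume g e s := by
  have hle : riemVolume g ≤
      (chartVolume g e).restrict e.source + (riemVolume g).restrict e.sourceᶜ := by
    refine iSup_le fun x => Measure.le_iff.2 fun t ht => ?_
    rw [← measure_inter_add_sdiff t e.open_source.measurableSet, Measure.add_apply,
      Measure.restrict_apply ht, Measure.restrict_apply ht]
    exact add_le_add
      (chartVolume_le_of_subset_source g (chart_mem_atlas E3 x) he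
        (ht.inter e.open_source.measurableSet) Set.inter_subset_right)
      (Measure.le_iff'.1 (le_iSup (fun x : M => chartVolume g (chartAt E3 x)) x) _)
  have h := hle s
  rwa [Measure.add_apply, Measure.restrict_apply hs, Measure.restrict_apply hs,
    Set.inter_eq_left.2 hse, (Set.disjoint_compl_right_iff_subset.2 hse).inter_eq, measure_empty,
    add_zero] at h

lemma exists_isOpen_chartVolume_lt_top {x : M} (he : e ∈ atlas E3 M) (hx : x ∈ e.source) :
    ∃ U ⊆ e.source, IsOpen U ∧ x ∈ U ∧ chartVolume g e U < ⊤ := by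
  have hbound : ∀ᶠ y in 𝓝 (e x), volDensity g e y < volDensity g e (e x) + 1 :=
    (continuousAt_volDensity g he (e.map_source hx)).eventually (gt_mem_nhds (lt_add_one _))
  obtain ⟨r, hr, hball⟩ := Metric.eventually_nhds_iff_ball.1 hbound
  have hU : IsOpen (e.source ∩ e ⁻¹' Metric.ball (e x) r) :=
    e.isOpen_inter_preimage Metric.isOpen_ball
  refine ⟨_, Set.inter_subset_left, hU, ⟨hx, Metric.mem_ball_self hr⟩, ?_⟩
  have hsub : e.target ∩ e.symm ⁻¹' (e.source ∩ e ⁻¹' Metric.ball (e x) r) ⊆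
      Metric.ball (e x) r := fun y hy => by
    simpa only [Set.mem_preimage, e.right_inv hy.1] using hy.2.2
  calc chartVolume g e (e.source ∩ e ⁻¹' Metric.ball (e x) r)
      ≤ ∫⁻ y in Metric.ball (e x) r, ENNReal.ofReal (volDensity g e y) := by
        rw [chartVolume_apply g hU.measurableSet]
        exact lintegral_mono_set hsub
    _ ≤ ∫⁻ _ in Metric.ball (e x) r, ENNReal.ofReal (volDensity g e (e x) + 1) :=
        setLIntegral_mono measurable_const fun y hy => ENNReal.ofReal_le_ofReal (hball y hy).le
    _ < ⊤ := by
        rw [setLIntegral_const]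
        exact ENNReal.mul_lt_top ENNReal.ofReal_lt_top measure_ball_lt_top

instance isLocallyFiniteMeasure_riemVolume : IsLocallyFiniteMeasure (riemVolume g) where
  finiteAtNhds x := by
    have he := chart_mem_atlas E3 x
    obtain ⟨U, hUsource, hU, hxU, hlt⟩ :=
      exists_isOpen_chartVolume_lt_top g he (mem_chart_source E3 x)
    exact ⟨U, hU.mem_nhds hxU,
      (riemVolume_le_chartVolume g he hU.measurableSet hUsource).trans_lt hlt⟩

end LocallyFinite

/-! ### Ricci flow of Milnor metrics -/

/-- `diagonal (d t)`, `0 ≤ t`, are the components in a Milnor frame with constants `lam` of a Ricci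
flow of diagonal metrics. As in `IsBergerFlow`, the derivative at `t = 0` is two-sided. -/
structure IsMilnorFlow (lam : Fin 3 → ℝ) (d : ℝ → Fin 3 → ℝ) : Prop where
  pos : ∀ t, 0 ≤ t → ∀ i, 0 < d t i
  hasDerivAt : ∀ t, 0 ≤ t → ∀ i, HasDerivAt (fun s => d s i) (-2 * milnorRicci lam (d t) i) t

lemma IsBergerFlow.isMilnorFlow {A B : ℝ → ℝ} (h : IsBergerFlow A B) :
    IsMilnorFlow ![-1, 1, 1] (fun t => ![A t, B t, B t]) where
  pos t ht i := by
    fin_cases i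
    exacts [h.left_pos t ht, h.right_pos t ht, h.right_pos t ht]
  hasDerivAt t ht i := by
    rw [milnorRicci_berger (h.left_pos t ht).ne' (h.right_pos t ht).ne']
    fin_cases i
    exacts [h.hasDerivAt_left t ht, h.hasDerivAt_right t ht, h.hasDerivAt_right t ht]

lemma IsMilnorFlow.hasDerivWithinAt_diagonal {lam : Fin 3 → ℝ} {d : ℝ → Fin 3 → ℝ}
    (hd : IsMilnorFlow lam d) {t : ℝ} (ht : 0 ≤ t) (i j : Fin 3) (s : Set ℝ) :
    HasDerivWithinAt (fun u => Matrix.diagonal (d u) i j)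
      (-2 * Matrix.diagonal (milnorRicci lam (d t)) i j) s t := by
  rcases eq_or_ne i j with rfl | hij
  · simpa only [Matrix.diagonal_apply_eq] using (hd.hasDerivAt t ht i).hasDerivWithinAt
  · simpa only [Matrix.diagonal_apply_ne _ hij, mul_zero] using hasDerivWithinAt_const t s (0 : ℝ)

section Flow

variable {G : Type*} [TopologicalSpace G] [ChartedSpace E3 G] [Group G] [LieGroup (𝓡 3) ∞ G]
  {e : Module.Basis (Fin 3) ℝ (GroupLieAlgebra (𝓡 3) G)} {lam mu nu : ℝ} {d : ℝ → Fin 3 → ℝ}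

lemma det_gram_frame_one_ne_zero (g : Metric G) : (gram g (frame e) 1).det ≠ 0 := by
  have hframe : (fun i => frame e i 1) = e := by
    have hmul : HasMFDerivAt (𝓡 3) (𝓡 3) (fun y : G => 1 * y) 1 _ :=
      (hasMFDerivAt_id 1).congr_of_eventuallyEq (.of_forall one_mul)
    funext i
    exact DFunLike.congr_fun hmul.mfderiv (e i)
  rw [det_gram_ne_zero_iff, hframe]
  exact e.linearIndependent

lemma hasConstantComponents_diagonal {g : Metric G} {δ : Fin 3 → ℝ}
    (he : MilnorRelations e lam mu nu) (hgram : ∀ x, gram g (frame e) x = Matrix.diagonal δ) :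
    HasConstantComponents g (frame e) (milnorConst ![lam, mu, nu]) (Matrix.diagonal δ) :=
  ⟨hgram, bracket_frame he⟩

lemma IsMilnorFlow.exists_isLeftInvariantRicciFlow (hd : IsMilnorFlow ![lam, mu, nu] d)
    (he : MilnorRelations e lam mu nu) {g₀ : Metric G} (hg₀ : IsLeftInvariant g₀)
    (hgram₀ : ∀ x, gram g₀ (frame e) x = Matrix.diagonal (d 0)) :
    ∃ g : ℝ → Metric G, IsLeftInvariantRicciFlow g e ∧ g 0 = g₀ := by
  have hmetric (t : ℝ) (ht : 0 ≤ t) : ∃ g : Metric G, IsLeftInvariant g ∧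
      ∀ x, gram g (frame e) x = Matrix.diagonal (d t) :=
    hg₀.exists_gram_eq_diagonal hgram₀ (hd.pos 0 le_rfl) (hd.pos t ht)
  have : Nonempty (Metric G) := ⟨g₀⟩
  choose! g' hg' hgram' using hmetric
  let g := Function.update g' 0 g₀
  have hg (t : ℝ) (ht : 0 ≤ t) :
      IsLeftInvariant (g t) ∧ ∀ x, gram (g t) (frame e) x = Matrix.diagonal (d t) := by
    rcases eq_or_ne t 0 with rfl | ht0
    · simpa only [g, Function.update_self] using ⟨hg₀, hgram₀⟩
    · simpa only [g, Function.update_of_ne ht0] using ⟨hg' t ht, hgram' t ht⟩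
  refine ⟨g, ⟨fun t ht => (hg t ht).1, fun t ht x i j => ?_⟩, Function.update_self ..⟩
  rw [ricci_milnor (hasConstantComponents_diagonal he (hg t ht).2) (hd.pos t ht)]
  exact (hd.hasDerivWithinAt_diagonal ht i j _).congr (fun s hs => congrFun₂ ((hg s hs).2 x) i j)
    (congrFun₂ ((hg t ht).2 x) i j)

lemma IsLeftInvariantRicciFlow.hasDerivWithinAt_gram {g : ℝ → Metric G}
    (hg : IsLeftInvariantRicciFlow g e) (he : MilnorRelations e lam mu nu) {t : ℝ} (ht : 0 ≤ t) :
    HasDerivWithinAt (fun s i j => gram (g s) (frame e) 1 i j)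
      (ricciFlowField (milnorConst ![lam, mu, nu]) fun i j => gram (g t) (frame e) 1 i j)
      (Set.Ici 0) t := by
  refine hasDerivWithinAt_pi.2 fun i => hasDerivWithinAt_pi.2 fun j => ?_
  have h := hg.ricciFlow t ht 1 i j
  rwa [((hg.leftInvariant t ht).hasConstantComponents he).ricci_eq
    (det_gram_frame_one_ne_zero (g t))] at h

lemma IsLeftInvariantRicciFlow.gram_eq_diagonal {g : ℝ → Metric G}
    (hg : IsLeftInvariantRicciFlow g e) (he : MilnorRelations e lam mu nu)
    (hd : IsMilnorFlow ![lam, mu, nu] d)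
    (hgram₀ : ∀ x, gram (g 0) (frame e) x = Matrix.diagonal (d 0)) {t : ℝ} (ht : 0 ≤ t) (x : G) :
    gram (g t) (frame e) x = Matrix.diagonal (d t) := by
  have hdiag (s : ℝ) (hs : 0 ≤ s) : HasDerivWithinAt (fun u i j => Matrix.diagonal (d u) i j)
      (ricciFlowField (milnorConst ![lam, mu, nu]) fun i j => Matrix.diagonal (d s) i j)
      (Set.Ici 0) s :=
    hasDerivWithinAt_pi.2 fun i => hasDerivWithinAt_pi.2 fun j =>
      (hd.hasDerivWithinAt_diagonal hs i j _).congr_deriv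
        (congrArg (-2 * ·) (ricciConst_milnor _ (fun k => (hd.pos s hs k).ne') i j)).symm
  have huniq := eq_of_hasDerivWithinAt_Ici (U := {p | (Matrix.of p).det ≠ 0})
    (fun p hp => contDiffAt_ricciFlowField _ hp) (fun s hs => hg.hasDerivWithinAt_gram he hs) hdiag
    (fun s _ => det_gram_frame_one_ne_zero (g s)) (fun s hs => (det_diagonal_pos (hd.pos s hs)).ne')
    (by simp only [hgram₀]) ht
  exact ((hg.leftInvariant t ht).gram_eq x 1).trans huniq

end Flow

/-! ### The Cotton-York functional -/

section Functional

lemma cottonYorkL1_milnor {M : Type*} [TopologicalSpace M] [ChartedSpace E3 M]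
    [IsManifold (𝓡 3) ∞ M] [MeasurableSpace M] {g h : Metric M} {F : Fin 3 → VField M}
    {lam d : Fin 3 → ℝ} (hg : HasConstantComponents g F (milnorConst lam) (Matrix.diagonal d))
    (hd : ∀ i, 0 < d i) (hh : ∀ x, gram h F x = 1) (K : Set M) :
    cottonYorkL1 g F K = √(∑ i, milnorCotton lam d i ^ 2) * (riemVolume h).real K := by
  have hdet : 0 < (Matrix.diagonal d).det := det_diagonal_pos hd
  have hsqrt : √(Matrix.diagonal d).det ≠ 0 := (Real.sqrt_pos.2 hdet).ne'
  have hnorm : cottonYorkNorm g F =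
      fun _ => √(∑ i, milnorCotton lam d i ^ 2) / √(Matrix.diagonal d).det :=
    funext fun x => eq_div_of_mul_eq hsqrt (cottonYorkNorm_mul_sqrt_det hg hd x)
  rw [cottonYorkL1, hnorm, setIntegral_const, riemVolume_eq_sqrt_det_smul g hg.gram_eq hdet hh,
    measureReal_ennreal_smul_apply, ENNReal.toReal_ofReal (Real.sqrt_nonneg _), smul_eq_mul]
  field_simp

variable {G : Type*} [TopologicalSpace G] [ChartedSpace E3 G] [Group G] [LieGroup (𝓡 3) ∞ G]
  {e : Module.Basis (Fin 3) ℝ (GroupLieAlgebra (𝓡 3) G)}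

lemma IsLeftInvariantDiagonal.gram_eq_one {h : Metric G}
    (hh : IsLeftInvariantDiagonal h e 1 1 1) (x : G) : gram h (frame e) x = 1 := by
  rw [hh.2 x, ← Matrix.diagonal_one]
  congr 1
  ext i
  fin_cases i <;> rfl

lemma cottonYorkL1_berger [MeasurableSpace G] (he : MilnorRelations e (-1) 1 1) {g h : Metric G}
    {A B : ℝ} (hA : 0 < A) (hB : 0 < B) (hg : IsLeftInvariantDiagonal g e A B B)
    (hh : IsLeftInvariantDiagonal h e 1 1 1) (K : Set G) :
    cottonYorkL1 g (frame e) K = 4 * √6 * (A / B) * (1 + A / B) * (riemVolume h).real K := by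
  have hd : ∀ i, 0 < ![A, B, B] i := by
    intro i
    fin_cases i
    exacts [hA, hB, hB]
  rw [cottonYorkL1_milnor (hasConstantComponents_diagonal he hg.2) hd hh.gram_eq_one,
    sqrt_sum_milnorCotton_sq_berger hA hB]

end Functional

namespace IsBergerFlow

variable {A B : ℝ → ℝ} {f : ℝ → ℝ} {V : ℝ}

lemma strictAntiOn_of_eq (h : IsBergerFlow A B)
    (hf : ∀ t, 0 ≤ t → f t = 4 * √6 * (A t / B t) * (1 + A t / B t) * V) (hV : 0 < V) :
    StrictAntiOn f (Set.Ici 0) := by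
  intro s hs t ht hst
  have hlt : A t / B t < A s / B s := h.strictAntiOn_div hs ht hst
  have hpos : 0 < A t / B t := div_pos (h.left_pos t ht) (h.right_pos t ht)
  rw [hf s hs, hf t ht]
  gcongr

lemma tendsto_of_eq (h : IsBergerFlow A B)
    (hf : ∀ t, 0 ≤ t → f t = 4 * √6 * (A t / B t) * (1 + A t / B t) * V) :
    Filter.Tendsto f Filter.atTop (𝓝 0) := by
  have hlim := ((h.tendsto_div.const_mul (4 * √6)).mul (h.tendsto_div.const_add 1)).mul_const V
  rw [mul_zero, zero_mul, zero_mul] at hlim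
  exact hlim.congr' ((Filter.eventually_ge_atTop 0).mono fun t ht => (hf t ht).symm)

end IsBergerFlow

end CottonYork

end

theorem theorem3p6_general
    {G : Type*} [TopologicalSpace G] [ChartedSpace CottonYork.E3 G] [Group G]
    [LieGroup (𝓡 3) ∞ G] [MeasurableSpace G] [BorelSpace G]
    (e : Module.Basis (Fin 3) ℝ (GroupLieAlgebra (𝓡 3) G))
    (he : CottonYork.MilnorRelations e (-1) 1 1)
    (g₀ : CottonYork.Metric G) (A₀ B₀ : ℝ) (hA : 0 < A₀) (hB : 0 < B₀)
    (hg₀ : CottonYork.IsLeftInvariantDiagonal g₀ e A₀ B₀ B₀) :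
    (∃ g : ℝ → CottonYork.Metric G, CottonYork.IsLeftInvariantRicciFlow g e ∧ g 0 = g₀) ∧
    ∃ h : CottonYork.Metric G, CottonYork.IsLeftInvariantDiagonal h e 1 1 1 ∧
      ∀ g : ℝ → CottonYork.Metric G, CottonYork.IsLeftInvariantRicciFlow g e → g 0 = g₀ →
        ∃ A B : ℝ → ℝ,
          (∀ t, 0 ≤ t → 0 < A t ∧ 0 < B t ∧
            CottonYork.IsLeftInvariantDiagonal (g t) e (A t) (B t) (B t)) ∧
          ∀ K : Set G, IsCompact K →
            (∀ t, 0 ≤ t → CottonYork.cottonYorkL1 (g t) (CottonYork.frame e) K =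
              4 * √6 * (A t / B t) * (1 + A t / B t) * (CottonYork.riemVolume h).real K) ∧
            (0 < CottonYork.riemVolume h K →
              StrictAntiOn (fun t => CottonYork.cottonYorkL1 (g t) (CottonYork.frame e) K)
                (Set.Ici 0)) ∧
            Filter.Tendsto (fun t => CottonYork.cottonYorkL1 (g t) (CottonYork.frame e) K)
              Filter.atTop (𝓝 0) := by
  obtain ⟨A, B, rfl, rfl, hAB⟩ := CottonYork.exists_isBergerFlow hA hB
  have hflow := hAB.isMilnorFlow
  obtain ⟨h, hh⟩ := hg₀.1.exists_gram_eq_diagonal hg₀.2 (hflow.pos 0 le_rfl)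
    (d' := ![1, 1, 1]) fun i => by fin_cases i <;> exact one_pos
  refine ⟨hflow.exists_isLeftInvariantRicciFlow he hg₀.1 hg₀.2, h, hh, fun g hg hg0 => ?_⟩
  have hdiag (t : ℝ) (ht : 0 ≤ t) :
      CottonYork.IsLeftInvariantDiagonal (g t) e (A t) (B t) (B t) :=
    ⟨hg.leftInvariant t ht, hg.gram_eq_diagonal he hflow (by rw [hg0]; exact hg₀.2) ht⟩
  refine ⟨A, B, fun t ht => ⟨hAB.left_pos t ht, hAB.right_pos t ht, hdiag t ht⟩, fun K hK => ?_⟩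
  have hL1 (t : ℝ) (ht : 0 ≤ t) := CottonYork.cottonYorkL1_berger he (hAB.left_pos t ht)
    (hAB.right_pos t ht) (hdiag t ht) hh K
  exact ⟨hL1, fun hvol => hAB.strictAntiOn_of_eq hL1
    (ENNReal.toReal_pos hvol.ne' hK.measure_lt_top.ne), hAB.tendsto_of_eq hL1⟩

theorem theorem3p6
    {G : Type*} [TopologicalSpace G] [ChartedSpace CottonYork.E3 G] [Group G]
    [LieGroup (𝓡 3) ∞ G] [T2Space G] [SecondCountableTopology G]
    [MeasurableSpace G] [BorelSpace G]
    -- `G` is the universal covering group of `SL(2, ℝ)`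
    (p : G →* Matrix.SpecialLinearGroup (Fin 2) ℝ) (hp : CottonYork.IsUniversalCoverSL2 p)
    -- a Milnor frame with `λ = -1`, `μ = ν = 1`
    (e : Module.Basis (Fin 3) ℝ (GroupLieAlgebra (𝓡 3) G))
    (he : CottonYork.MilnorRelations e (-1) 1 1)
    -- the initial metric
    (g₀ : CottonYork.Metric G) (A₀ B₀ C₀ : ℝ) (hA : 0 < A₀) (hB : 0 < B₀) (hBC : B₀ = C₀)
    (hg₀ : CottonYork.IsLeftInvariantDiagonal g₀ e A₀ B₀ C₀) :
    -- the Ricci flow starting at `g₀` exists for all positive time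
    (∃ g : ℝ → CottonYork.Metric G, CottonYork.IsLeftInvariantRicciFlow g e ∧ g 0 = g₀) ∧
    -- `h = ω^1 ⊗ ω^1 + ω^2 ⊗ ω^2 + ω^3 ⊗ ω^3`
    ∃ h : CottonYork.Metric G, CottonYork.IsLeftInvariantDiagonal h e 1 1 1 ∧
      ∀ g : ℝ → CottonYork.Metric G, CottonYork.IsLeftInvariantRicciFlow g e → g 0 = g₀ →
        -- `g(t) = A(t) ω^1 ⊗ ω^1 + B(t) (ω^2 ⊗ ω^2 + ω^3 ⊗ ω^3)`
        ∃ A B : ℝ → ℝ,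
          (∀ t, 0 ≤ t → 0 < A t ∧ 0 < B t ∧
            CottonYork.IsLeftInvariantDiagonal (g t) e (A t) (B t) (B t)) ∧
          ∀ K : Set G, IsCompact K →
            (∀ t, 0 ≤ t → CottonYork.cottonYorkL1 (g t) (CottonYork.frame e) K =
              4 * √6 * (A t / B t) * (1 + A t / B t) * (CottonYork.riemVolume h).real K) ∧
            (0 < CottonYork.riemVolume h K →
              StrictAntiOn (fun t => CottonYork.cottonYorkL1 (g t) (CottonYork.frame e) K)
                (Set.Ici 0)) ∧
            Filter.Tendsto (fun t => CottonYork.cottonYorkL1 (g t) (CottonYork.frame e) K)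
              Filter.atTop (𝓝 0) := by
  subst hBC
  exact theorem3p6_general e he g₀ A₀ B₀ hA hB hg₀
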